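/- Two holomorphic map germs $F,G:(\mathbb{C}^4,0)\to(\mathbb{C}^2,0)$ are called $\mathcal{K}$-equivalent if there are a germ of a biholomorphic map $\varphi:(\mathbb{C}^4,0)\to(\mathbb{C}^4,0)$ and an invertible $2\times 2$-matrix $A$ of germs at $0$ of holomorphic functions such that $F\circ\varphi=A\,G$ (with $G$ regarded as a column vector). The eight virtual quadrangle complete intersection singularities are given by the following pairs of polynomials $({\bf h}_1,{\bf h}_2)$ in $\mathbb{C}[x,y,z,w]$: - $J'_{2,-1}$: $(xy-w^2,\ -x^2z+yw+z^2+xw^2)$ - $K'_{1,-1}$: $(xy-w^2,\ -x^2w+z^2+yz+xw^2)$ - $K^\flat_{1,-1}$: $(xy-w^2,\ -x^2w+z^2+yz+x^2z)$ - $L_{1,-1}$: $(xy-zw,\ -x^2w+z^2+yw+xw^2)$ - $L^\sharp_{1,-1}$: $(xy-zw,\ -x^2w+z^2+yw+x^2z)$ - $M_{1,-1}$: $(xy-w^2,\ -yz+xw+z^3+w^2)$ - $M^\sharp_{1,-1}$: $(xy-zw,\ -z^2+yw+x^2w+yz)$ - $I_{1,-1}$: $(xy-w^3,\ -xw+z^2+yz+xz)$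 Let ${\bf h}_1':=xy-w^2-z^2$ in the three cases $J'_{2,-1}$, $K'_{1,-1}$, $K^\flat_{1,-1}$ (which are suspensions of curve singularities), and ${\bf h}_1':={\bf h}_1$ in the other five cases. The numbers $\gamma_1,\gamma_2;\gamma_3,\gamma_4$ are called Gabrielov numbers of the virtual singularity if the map germ $({\bf h}_1',\ {\bf h}_2-zw)$ at the origin is $\mathcal{K}$-equivalent to the map germ $$(xy-z^{\gamma_1}-w^{\gamma_2},\ x^{\gamma_3}+y^{\gamma_4}-zw)$$ at the origin, which defines a cusp singularity. **Proposition.** The Gabrielov numbers $\gamma_1,\gamma_2;\gamma_3,\gamma_4$ of the virtual quadrangle complete intersection singularities are: - $J'_{2,-1}$: $2,2;2,6$ - $K'_{1,-1}$: $2,2;4,4$ - $K^\flat_{1,-1}$: $2,2;3,5$ - $L_{1,-1}$: $2,4;2,4$ - $L^\sharp_{1,-1}$: $2,3;2,5$ - $M_{1,-1}$: $3,3;2,4$ - $M^\sharp_{1,-1}$: $2,3;3,4$ - $I_{1,-1}$: $3,3;3,3$ -/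

import Mathlib

open scoped Topology

/-- Contact equivalence (`𝒦`-equivalence) of the germs at the origin of two maps
`f, g : ℂⁿ → ℂᵖ`: there are a germ `φ` of a biholomorphic map `(ℂⁿ, 0) → (ℂⁿ, 0)` (with inverse
germ `ψ`) and an invertible `p × p`-matrix `A` of holomorphic function germs at `0` such that
`f ∘ φ = A g` as germs at `0`. -/
def KEquivalent {n p : ℕ} (f g : (Fin n → ℂ) → (Fin p → ℂ)) : Prop :=
  ∃ (φ ψ : (Fin n → ℂ) → (Fin n → ℂ)) (A : (Fin n → ℂ) → Matrix (Fin p) (Fin p) ℂ),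
    AnalyticAt ℂ φ 0 ∧ φ 0 = 0 ∧
    AnalyticAt ℂ ψ 0 ∧ ψ 0 = 0 ∧
    (∀ᶠ v in 𝓝 0, ψ (φ v) = v) ∧
    (∀ᶠ v in 𝓝 0, φ (ψ v) = v) ∧
    (∀ i j, AnalyticAt ℂ (fun v => A v i j) 0) ∧
    (A 0).det ≠ 0 ∧
    ∀ᶠ v in 𝓝 0, f (φ v) = (A v).mulVec (g v)

/-- The map `ℂ⁴ → ℂ²` given by a pair of polynomials in four variables. -/
noncomputable def pairMap (p q : MvPolynomial (Fin 4) ℂ) : (Fin 4 → ℂ) → (Fin 2 → ℂ) :=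
  fun v => ![MvPolynomial.eval v p, MvPolynomial.eval v q]

/-- The eight virtual quadrangle complete intersection singularities
`J'_{2,-1}`, `K'_{1,-1}`, `K^♭_{1,-1}`, `L_{1,-1}`, `L^♯_{1,-1}`, `M_{1,-1}`, `M^♯_{1,-1}`,
`I_{1,-1}`. -/
inductive VirtualSing : Type
  | J'
  | K'
  | Kflat
  | L
  | Lsharp
  | M
  | Msharp
  | I

namespace VirtualSing

/-- The coordinates `x, y, z, w` on `ℂ⁴`. -/
noncomputable abbrev x : MvPolynomial (Fin 4) ℂ := MvPolynomial.X 0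
noncomputable abbrev y : MvPolynomial (Fin 4) ℂ := MvPolynomial.X 1
noncomputable abbrev z : MvPolynomial (Fin 4) ℂ := MvPolynomial.X 2
noncomputable abbrev w : MvPolynomial (Fin 4) ℂ := MvPolynomial.X 3

/-- The first polynomial `h₁` of the pair defining the virtual singularity. -/
noncomputable def h₁ : VirtualSing → MvPolynomial (Fin 4) ℂ
  | J' => x * y - w ^ 2
  | K' => x * y - w ^ 2
  | Kflat => x * y - w ^ 2
  | L => x * y - z * w
  | Lsharp => x * y - z * w
  | M => x * y - w ^ 2
  | Msharp => x * y - z * w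
  | I => x * y - w ^ 3

/-- The second polynomial `h₂` of the pair defining the virtual singularity. -/
noncomputable def h₂ : VirtualSing → MvPolynomial (Fin 4) ℂ
  | J' => -x ^ 2 * z + y * w + z ^ 2 + x * w ^ 2
  | K' => -x ^ 2 * w + z ^ 2 + y * z + x * w ^ 2
  | Kflat => -x ^ 2 * w + z ^ 2 + y * z + x ^ 2 * z
  | L => -x ^ 2 * w + z ^ 2 + y * w + x * w ^ 2
  | Lsharp => -x ^ 2 * w + z ^ 2 + y * w + x ^ 2 * z
  | M => -y * z + x * w + z ^ 3 + w ^ 2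
  | Msharp => -z ^ 2 + y * w + x ^ 2 * w + y * z
  | I => -x * w + z ^ 2 + y * z + x * z

/-- The first polynomial used in the definition of the Gabrielov numbers. In the three cases that
are suspensions of curve singularities, it is `xy - w² - z²`; otherwise it is `h₁`. -/
noncomputable def gabrielovH₁ : VirtualSing → MvPolynomial (Fin 4) ℂ
  | J' => x * y - w ^ 2 - z ^ 2
  | K' => x * y - w ^ 2 - z ^ 2
  | Kflat => x * y - w ^ 2 - z ^ 2
  | S => h₁ S

/-- The pair `(h₁, h₂ - zw)` defining the deformed singularity `(X', 0)`. -/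
noncomputable def deformation (S : VirtualSing) : (Fin 4 → ℂ) → (Fin 2 → ℂ) :=
  pairMap (gabrielovH₁ S) (h₂ S - z * w)

/-- The pair `(xy - z^γ₁ - w^γ₂, x^γ₃ + y^γ₄ - zw)` defining a cusp singularity. -/
noncomputable def cusp (γ₁ γ₂ γ₃ γ₄ : ℕ) : (Fin 4 → ℂ) → (Fin 2 → ℂ) :=
  pairMap (x * y - z ^ γ₁ - w ^ γ₂) (x ^ γ₃ + y ^ γ₄ - z * w)

/-- `γ₁, γ₂; γ₃, γ₄` are Gabrielov numbers of the virtual singularity `S`. -/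
def HasGabrielovNumbers (S : VirtualSing) (γ₁ γ₂ γ₃ γ₄ : ℕ) : Prop :=
  KEquivalent (deformation S) (cusp γ₁ γ₂ γ₃ γ₄)

end VirtualSing

/-!
Each deformation is brought to its cusp by explicit coordinate changes, followed by a finite
determinacy argument that replaces a polynomial pair of the right shape by the cusp itself.

*Determinacy.* Suppose that the first component of a map germ is
`v x y + r z ^ γ₁ + s w ^ γ₂` and the second one is `w₀ z w + p x ^ γ₃ + q y ^ γ₄`, with nonzero
coefficients and up to terms in `𝔪 · (x y, z w, x ^ γ₃, y ^ γ₄, z ^ γ₁, w ^ γ₂)`. Then it is contact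
equivalent to the cusp (`kEquivalent_cusp_of_cofactors`). One looks for a substitution
`x ↦ α₀ x + β₀ y ^ (γ₄ - 1)`, and so on, with analytic `α` and `β`, `β(0) = 0`. It keeps both
components in the ideal, and asking that the result be a matrix times the cusp gives a system of
equations for `α` and `β` of fixed-point form `(α, β) = Ψ(v, α, β)`, where `Ψ` is constant for
`v = 0`; the implicit function theorem solves it (`exists_analyticAt_fixedPoint`). The equations for
`α` are scaling equations, linear in logarithms, and solvable because
`(1 / γ₁ + 1 / γ₂) (1 / γ₃ + 1 / γ₄) ≠ 1` (`exists_analyticAt_scaling`). This is where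
the inequality defining cusp singularities enters.

*The shape condition.* Modulo `x y` and `z w` a polynomial is determined by its restrictions to the
four coordinate planes `(x, z)`, `(x, w)`, `(y, z)`, `(y, w)`, so the hypothesis above amounts to
identities between values at truncated (that is, nilpotent) points of coordinate planes, axes and
two diagonals. This is `HasCuspShape`; it turns the hypothesis into ring identities in two nilpotent
variables (`kEquivalent_cusp_of_hasCuspShape`).

*The coordinate changes.* For each of the eight singularities a linear change of coordinates, and of
the basis of the pencil, puts the quadratic parts in the form required of the cusp
(`kEquivalent_deformation_normalForm`). A polynomial coordinate change tangent to the identity,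
found degree by degree, then removes all monomials that violate the shape condition
(`hasCuspShape_normalForm₁`, `hasCuspShape_normalForm₂`).
-/

/-! ### Contact equivalence and the inverse function theorem -/

theorem KEquivalent.trans {n p : ℕ} {f g h : (Fin n → ℂ) → (Fin p → ℂ)}
    (hfg : KEquivalent f g) (hgh : KEquivalent g h) : KEquivalent f h := by
  obtain ⟨φ₁, ψ₁, A₁, hφ₁, hφ₁0, hψ₁, hψ₁0, hl₁, hr₁, hA₁, hd₁, he₁⟩ := hfg
  obtain ⟨φ₂, ψ₂, A₂, hφ₂, hφ₂0, hψ₂, hψ₂0, hl₂, hr₂, hA₂, hd₂, he₂⟩ := hgh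
  have tφ₂ : Filter.Tendsto φ₂ (𝓝 0) (𝓝 0) := by
    simpa [ContinuousAt, hφ₂0] using hφ₂.continuousAt
  have tφ₁ : Filter.Tendsto φ₁ (𝓝 0) (𝓝 0) := by
    simpa [ContinuousAt, hφ₁0] using hφ₁.continuousAt
  have tψ₁ : Filter.Tendsto ψ₁ (𝓝 0) (𝓝 0) := by
    simpa [ContinuousAt, hψ₁0] using hψ₁.continuousAt
  refine ⟨fun v => φ₁ (φ₂ v), fun v => ψ₂ (ψ₁ v), fun v => A₁ (φ₂ v) * A₂ v,
    ?_, by simp [hφ₁0, hφ₂0], ?_, by simp [hψ₁0, hψ₂0], ?_, ?_, ?_, ?_, ?_⟩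
  · exact AnalyticAt.fun_comp (by simpa [hφ₂0] using hφ₁) hφ₂
  · exact AnalyticAt.fun_comp (by simpa [hψ₁0] using hψ₂) hψ₁
  · filter_upwards [hl₂, tφ₂.eventually hl₁] with v h2 h1
    rw [h1, h2]
  · filter_upwards [hr₁, tψ₁.eventually hr₂] with v h1 h2
    rw [h2, h1]
  · intro i j
    simp only [Matrix.mul_apply]
    refine Finset.analyticAt_fun_sum _ fun k _ => ?_
    exact (AnalyticAt.fun_comp (g := fun v => A₁ v i k) (by simpa [hφ₂0] using hA₁ i k) hφ₂).mul
      (hA₂ k j)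
  · simp [hφ₂0, hd₁, hd₂]
  · filter_upwards [he₂, tφ₂.eventually he₁] with v h2 h1
    rw [h1, h2, Matrix.mulVec_mulVec]

/-- The inverse function theorem for analytic maps: a germ with bijective differential has an
analytic inverse germ. -/
theorem AnalyticAt.exists_local_inverse {E F : Type*} [NormedAddCommGroup E] [NormedSpace ℂ E]
    [CompleteSpace E] [NormedAddCommGroup F] [NormedSpace ℂ F] [CompleteSpace F] {f : E → F}
    {a : E} {f' : E ≃L[ℂ] F} (hf : AnalyticAt ℂ f a)
    (hf' : HasFDerivAt f (f' : E →L[ℂ] F) a) :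
    ∃ g : F → E, AnalyticAt ℂ g (f a) ∧ g (f a) = a ∧ (∀ᶠ x in 𝓝 a, g (f x) = x) ∧
      ∀ᶠ y in 𝓝 (f a), f (g y) = y := by
  have hs : HasStrictFDerivAt f (f' : E →L[ℂ] F) a := by
    have := hf.hasStrictFDerivAt
    rwa [hf'.fderiv] at this
  have hc : ContDiffAt ℂ ⊤ f a := hf.contDiffAt
  refine ⟨hc.localInverse hf' (by simp), ?_, hc.localInverse_apply_image hf' (by simp), ?_, ?_⟩
  · exact (hc.to_localInverse hf' (by simp)).analyticAt
  · exact hs.eventually_left_inverse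
  · exact hs.eventually_right_inverse

/-- For contact equivalence it is enough to give a coordinate change with invertible differential;
its inverse germ is supplied by the inverse function theorem. -/
theorem KEquivalent.of_coordinates {n p : ℕ} {f g : (Fin n → ℂ) → (Fin p → ℂ)}
    {φ : (Fin n → ℂ) → (Fin n → ℂ)} {φ' : (Fin n → ℂ) ≃L[ℂ] (Fin n → ℂ)}
    {A : (Fin n → ℂ) → Matrix (Fin p) (Fin p) ℂ} (hφ : AnalyticAt ℂ φ 0) (hφ0 : φ 0 = 0)
    (hφ' : HasFDerivAt φ (φ' : (Fin n → ℂ) →L[ℂ] (Fin n → ℂ)) 0)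
    (hA : ∀ i j, AnalyticAt ℂ (fun v => A v i j) 0) (hA0 : (A 0).det ≠ 0)
    (h : ∀ᶠ v in 𝓝 0, f (φ v) = (A v).mulVec (g v)) : KEquivalent f g := by
  obtain ⟨ψ, hψ, hψ0, hl, hr⟩ := hφ.exists_local_inverse hφ'
  rw [hφ0] at hψ hψ0 hr
  exact ⟨φ, ψ, A, hφ, hφ0, hψ, hψ0, hl, hr, hA, hA0, h⟩

/-- An implicit function theorem in fixed-point form. If `Ψ(v, y)` does not depend on `y` at
`v = 0`, the differential of `y - Ψ(v, y)` in `y` is the identity there, so `y = Ψ(v, y)` has an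
analytic solution `y = η(v)`. -/
theorem exists_analyticAt_fixedPoint {E Y : Type*} [NormedAddCommGroup E] [NormedSpace ℂ E]
    [CompleteSpace E] [NormedAddCommGroup Y] [NormedSpace ℂ Y] [CompleteSpace Y]
    {Ψ : E × Y → Y} {y₀ : Y} (hΨ : AnalyticAt ℂ Ψ (0, y₀))
    (h0 : ∀ᶠ y in 𝓝 y₀, Ψ (0, y) = y₀) :
    ∃ η : E → Y, AnalyticAt ℂ η 0 ∧ η 0 = y₀ ∧ ∀ᶠ v in 𝓝 0, Ψ (v, η v) = η v := by
  set D := fderiv ℂ Ψ (0, y₀)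
  have hD : HasFDerivAt Ψ D (0, y₀) := hΨ.differentiableAt.hasFDerivAt
  have hD0 : ∀ y, D (0, y) = 0 := by
    intro y
    have h1 : HasFDerivAt (fun y => Ψ (0, y)) (D.comp (ContinuousLinearMap.inr ℂ E Y)) y₀ :=
      HasFDerivAt.comp (g := Ψ) (f := fun y : Y => ((0 : E), y)) y₀ hD
        (hasFDerivAt_prodMk_right (0 : E) y₀)
    have h2 : HasFDerivAt (fun y => Ψ (0, y)) (0 : Y →L[ℂ] Y) y₀ :=
      (hasFDerivAt_const y₀ y₀).congr_of_eventuallyEq h0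
    have := congrArg (fun T : Y →L[ℂ] Y => T y) (h1.unique h2)
    simpa using this
  have hD1 : ∀ v y, D (v, y) = D (v, 0) := by
    intro v y
    have : ((v, y) : E × Y) = (v, 0) + (0, y) := by simp
    rw [this, map_add, hD0, add_zero]
  -- `D` factors through the first component, so `(v, y) ↦ (v, y - D (v, y))` is unipotent
  let T : (E × Y) ≃L[ℂ] (E × Y) := ContinuousLinearEquiv.equivOfInverse
    ((ContinuousLinearMap.fst ℂ E Y).prod (ContinuousLinearMap.snd ℂ E Y - D))
    ((ContinuousLinearMap.fst ℂ E Y).prod (ContinuousLinearMap.snd ℂ E Y + D))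
    (by rintro ⟨v, y⟩; simp [hD1 v (y - _), hD1 v y])
    (by rintro ⟨v, y⟩; simp [hD1 v (y + _), hD1 v y])
  let h : E × Y → E × Y := fun q => (q.1, q.2 - Ψ q)
  have hh : AnalyticAt ℂ h (0, y₀) := by
    exact analyticAt_fst.prod (analyticAt_snd.sub hΨ)
  have hh' : HasFDerivAt h (T : (E × Y) →L[ℂ] (E × Y)) (0, y₀) :=
    hasFDerivAt_fst.prodMk (hasFDerivAt_snd.sub hD)
  obtain ⟨g, hg, hg0, -, hr⟩ := hh.exists_local_inverse hh'
  have hh0 : h (0, y₀) = (0, 0) := by simp [h, h0.self_of_nhds]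
  rw [hh0] at hg hg0 hr
  have hi : AnalyticAt ℂ (fun v : E => ((v, 0) : E × Y)) 0 := by fun_prop
  have ht : Filter.Tendsto (fun v : E => ((v, 0) : E × Y)) (𝓝 0) (𝓝 (0, 0)) := hi.continuousAt
  refine ⟨fun v => (g (v, 0)).2, ?_, by simp [hg0], ?_⟩
  · exact AnalyticAt.fun_comp analyticAt_snd
      (AnalyticAt.fun_comp (f := fun v : E => ((v, 0) : E × Y)) hg hi)
  · filter_upwards [ht.eventually hr] with v hv
    simp only [h, Prod.mk.injEq] at hv
    have : ((v, (g (v, 0)).2) : E × Y) = g (v, 0) := Prod.ext hv.1.symm rfl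
    rw [this]
    exact (sub_eq_zero.1 hv.2).symm

/-! ### The middle part of the binomial formula -/

/-- The middle part of the binomial formula,
`(p + q) ^ (k + 2) = p ^ (k + 2) + q ^ (k + 2) + p q · binomMid k p q`. -/
noncomputable def binomMid : ℕ → ℂ → ℂ → ℂ
  | 0, _, _ => 2
  | k + 1, p, q => p ^ (k + 1) + q ^ (k + 1) + (p + q) * binomMid k p q

theorem add_pow_eq_binomMid (k : ℕ) (p q : ℂ) :
    (p + q) ^ (k + 2) = p ^ (k + 2) + q ^ (k + 2) + p * q * binomMid k p q := by
  induction k with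
  | zero => simp only [binomMid]; ring
  | succ k ih =>
    rw [show k + 1 + 2 = (k + 2) + 1 by ring, pow_succ, ih]
    simp only [binomMid]
    ring

/-- For `k = 0` the value is the constant `2` instead; exponents `2` are special for this reason. -/
theorem binomMid_zero_zero {k : ℕ} (hk : k ≠ 0) : binomMid k 0 0 = 0 := by
  obtain ⟨k, rfl⟩ := Nat.exists_eq_succ_of_ne_zero hk
  simp [binomMid]

@[fun_prop]
theorem AnalyticAt.binomMid {E : Type*} [NormedAddCommGroup E] [NormedSpace ℂ E] (k : ℕ)
    {p q : E → ℂ} {e : E} (hp : AnalyticAt ℂ p e) (hq : AnalyticAt ℂ q e) :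
    AnalyticAt ℂ (fun v => binomMid k (p v) (q v)) e := by
  induction k with
  | zero => simp only [_root_.binomMid]; fun_prop
  | succ k ih => simp only [_root_.binomMid]; fun_prop

/-! ### A substitution preserving the shape of a cusp -/

/-- Under the substitution `s ↦ λ s + μ t ^ (n + 1)`, `t ↦ κ t + ν s ^ (m + 1)`, the expression
`p s t + q s ^ (m + 2) + r t ^ (n + 2)` becomes one of the same shape. This is its new coefficient
at `s t`. -/
noncomputable def crossCoeff (m n : ℕ) (p q r l μ κ ν s t : ℂ) : ℂ :=
  p * (l * κ + μ * ν * s ^ m * t ^ n)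
    + q * (l * μ * t ^ n * binomMid m (l * s) (μ * t ^ (n + 1)))
    + r * (κ * ν * s ^ m * binomMid n (κ * t) (ν * s ^ (m + 1)))

/-- The new coefficient at `s ^ (m + 2)` in the substitution of `crossCoeff`; the one at
`t ^ (n + 2)` is the same with the two variables interchanged. -/
noncomputable def sideCoeff (m n : ℕ) (p q r l ν s : ℂ) : ℂ :=
  p * (l * ν) + q * l ^ (m + 2) + r * (ν ^ (n + 2) * s ^ (m * n + m + n))

theorem substitution_identity (m n : ℕ) (p q r l μ κ ν s t : ℂ) :
    p * ((l * s + μ * t ^ (n + 1)) * (κ * t + ν * s ^ (m + 1)))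
      + q * (l * s + μ * t ^ (n + 1)) ^ (m + 2) + r * (κ * t + ν * s ^ (m + 1)) ^ (n + 2) =
    crossCoeff m n p q r l μ κ ν s t * (s * t) + sideCoeff m n p q r l ν s * s ^ (m + 2)
      + sideCoeff n m p r q κ μ t * t ^ (n + 2) := by
  have h1 : (t ^ (n + 1)) ^ (m + 2) = t ^ (n * m + n + m) * t ^ (n + 2) := by
    rw [← pow_mul, ← pow_add]; congr 1; ring
  have h2 : (s ^ (m + 1)) ^ (n + 2) = s ^ (m * n + m + n) * s ^ (m + 2) := by
    rw [← pow_mul, ← pow_add]; congr 1; ring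
  rw [add_pow_eq_binomMid, add_pow_eq_binomMid, mul_pow l, mul_pow μ, mul_pow κ, mul_pow ν, h1, h2,
    crossCoeff, sideCoeff, sideCoeff]
  ring

@[fun_prop]
theorem AnalyticAt.crossCoeff {E : Type*} [NormedAddCommGroup E] [NormedSpace ℂ E] (m n : ℕ)
    {p q r l μ κ ν s t : E → ℂ} {e : E} (hp : AnalyticAt ℂ p e) (hq : AnalyticAt ℂ q e)
    (hr : AnalyticAt ℂ r e) (hl : AnalyticAt ℂ l e) (hμ : AnalyticAt ℂ μ e)
    (hκ : AnalyticAt ℂ κ e) (hν : AnalyticAt ℂ ν e) (hs : AnalyticAt ℂ s e)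
    (ht : AnalyticAt ℂ t e) :
    AnalyticAt ℂ (fun v => crossCoeff m n (p v) (q v) (r v) (l v) (μ v) (κ v) (ν v) (s v) (t v))
      e := by
  unfold _root_.crossCoeff
  fun_prop

@[fun_prop]
theorem AnalyticAt.sideCoeff {E : Type*} [NormedAddCommGroup E] [NormedSpace ℂ E] (m n : ℕ)
    {p q r l ν s : E → ℂ} {e : E} (hp : AnalyticAt ℂ p e) (hq : AnalyticAt ℂ q e)
    (hr : AnalyticAt ℂ r e) (hl : AnalyticAt ℂ l e) (hν : AnalyticAt ℂ ν e)
    (hs : AnalyticAt ℂ s e) :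
    AnalyticAt ℂ (fun v => sideCoeff m n (p v) (q v) (r v) (l v) (ν v) (s v)) e := by
  unfold _root_.sideCoeff
  fun_prop

/-! ### The scaling equations -/

/-- Analytic solution of the scaling equations
`A₀ σ₀ σ₁ = - A₁ σ₂ ^ a = - A₂ σ₃ ^ b` and `- A₃ σ₂ σ₃ = A₄ σ₀ ^ c = A₅ σ₁ ^ d`.
They are linear in the logarithms of the `σᵢ`, with determinant proportional to
`a b c d - (a + b) (c + d)`. -/
theorem exists_analyticAt_scaling {a b c d : ℕ} (ha : a ≠ 0) (hb : b ≠ 0) (hc : c ≠ 0)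
    (hd : d ≠ 0) (h : (a + b) * (c + d) ≠ a * b * c * d) {A₀ : Fin 6 → ℂ} (hA₀ : ∀ i, A₀ i ≠ 0) :
    ∃ σ : (Fin 6 → ℂ) → Fin 4 → ℂ, AnalyticAt ℂ σ A₀ ∧ (∀ A i, σ A i ≠ 0) ∧
      ∀ᶠ A in 𝓝 A₀,
        A 0 * (σ A 0 * σ A 1) = -(A 1 * σ A 2 ^ a) ∧ A 0 * (σ A 0 * σ A 1) = -(A 2 * σ A 3 ^ b) ∧
        -(A 3 * (σ A 2 * σ A 3)) = A 4 * σ A 0 ^ c ∧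
        -(A 3 * (σ A 2 * σ A 3)) = A 5 * σ A 1 ^ d := by
  -- the signs with which the coefficients enter the scaling equations
  let ε : Fin 6 → ℂ := ![1, -1, -1, -1, 1, 1]
  have hε : ∀ i, ε i ≠ 0 := by intro i; fin_cases i <;> simp [ε]
  -- a branch of the logarithm of `ε i * A i` near `A₀`
  let L : Fin 6 → (Fin 6 → ℂ) → ℂ := fun i A =>
    Complex.log (ε i * A₀ i) + Complex.log (A i / A₀ i)
  have hL : ∀ i, AnalyticAt ℂ (L i) A₀ := by
    intro i
    refine analyticAt_const.add (AnalyticAt.clog ?_ (by simp [hA₀ i]))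
    exact ((ContinuousLinearMap.proj (R := ℂ) (φ := fun _ : Fin 6 => ℂ) i).analyticAt A₀).div
      analyticAt_const (hA₀ i)
  have hexp : ∀ i (A : Fin 6 → ℂ), A i ≠ 0 → Complex.exp (L i A) = ε i * A i := by
    intro i A hA
    have h0 := hA₀ i
    simp only [L]
    rw [Complex.exp_add, Complex.exp_log (mul_ne_zero (hε i) (hA₀ i)),
      Complex.exp_log (div_ne_zero hA (hA₀ i))]
    field_simp
  have haC : (a : ℂ) ≠ 0 := by exact_mod_cast ha
  have hbC : (b : ℂ) ≠ 0 := by exact_mod_cast hb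
  have hcC : (c : ℂ) ≠ 0 := by exact_mod_cast hc
  have hdC : (d : ℂ) ≠ 0 := by exact_mod_cast hd
  have hdet : (a * b * c * d - (a + b) * (c + d) : ℂ) ≠ 0 := by
    rw [sub_ne_zero]; exact_mod_cast h.symm
  -- `S` and `T` are the logarithms of the two common values
  let S : (Fin 6 → ℂ) → ℂ := fun A =>
    (a * b * c * d * L 0 A - a * b * d * L 4 A - a * b * c * L 5 A
      + (c + d) * (a * b * L 3 A - b * L 1 A - a * L 2 A)) / (a * b * c * d - (a + b) * (c + d))
  let T : (Fin 6 → ℂ) → ℂ := fun A =>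
    L 3 A - L 1 A / a - L 2 A / b + S A / a + S A / b
  have hS : AnalyticAt ℂ S A₀ := by
    simp only [S]
    exact AnalyticAt.div (by fun_prop) (by fun_prop) hdet
  have hT : AnalyticAt ℂ T A₀ := by
    simp only [T, div_eq_mul_inv]
    fun_prop
  have hST : ∀ A, S A = L 0 A + (T A - L 4 A) / c + (T A - L 5 A) / d := by
    intro A
    have hS' : S A * (a * b * c * d - (a + b) * (c + d)) = a * b * c * d * L 0 A
        - a * b * d * L 4 A - a * b * c * L 5 A
        + (c + d) * (a * b * L 3 A - b * L 1 A - a * L 2 A) := div_mul_cancel₀ _ hdet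
    simp only [T]
    field_simp
    linear_combination hS'
  refine ⟨fun A => ![Complex.exp ((T A - L 4 A) / c), Complex.exp ((T A - L 5 A) / d),
    Complex.exp ((S A - L 1 A) / a), Complex.exp ((S A - L 2 A) / b)], ?_, ?_, ?_⟩
  · rw [show (fun A => ![Complex.exp ((T A - L 4 A) / c), Complex.exp ((T A - L 5 A) / d),
      Complex.exp ((S A - L 1 A) / a), Complex.exp ((S A - L 2 A) / b)]) = fun A i =>
      (![fun A => Complex.exp ((T A - L 4 A) / c), fun A => Complex.exp ((T A - L 5 A) / d),
      fun A => Complex.exp ((S A - L 1 A) / a), fun A => Complex.exp ((S A - L 2 A) / b)] :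
        Fin 4 → (Fin 6 → ℂ) → ℂ) i A by ext A i; fin_cases i <;> rfl]
    refine AnalyticAt.pi fun i => ?_
    fin_cases i <;> (simp [div_eq_mul_inv]; fun_prop)
  · intro A i
    fin_cases i <;> simp [Complex.exp_ne_zero]
  · have hne : ∀ i, ∀ᶠ A in 𝓝 A₀, A i ≠ 0 := fun i =>
      (continuous_apply i).continuousAt.eventually_ne (hA₀ i)
    filter_upwards [Filter.eventually_all.2 hne] with A hA
    have e0 := hexp 0 A (hA 0)
    have e1 := hexp 1 A (hA 1)
    have e2 := hexp 2 A (hA 2)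
    have e3 := hexp 3 A (hA 3)
    have e4 := hexp 4 A (hA 4)
    have e5 := hexp 5 A (hA 5)
    simp only [ε] at e0 e1 e2 e3 e4 e5
    simp at e0 e1 e2 e3 e4 e5
    simp
    have k0 : A 0 * (Complex.exp ((T A - L 4 A) / c) * Complex.exp ((T A - L 5 A) / d)) =
        Complex.exp (S A) := by
      rw [← e0, ← Complex.exp_add, ← Complex.exp_add, hST A]; ring_nf
    have k1 : -(A 1 * Complex.exp ((S A - L 1 A) / a) ^ a) = Complex.exp (S A) := by
      rw [← neg_mul, ← e1, ← Complex.exp_nat_mul, ← Complex.exp_add]; congr 1; field_simp; ring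
    have k2 : -(A 2 * Complex.exp ((S A - L 2 A) / b) ^ b) = Complex.exp (S A) := by
      rw [← neg_mul, ← e2, ← Complex.exp_nat_mul, ← Complex.exp_add]; congr 1; field_simp; ring
    have k3 : -(A 3 * (Complex.exp ((S A - L 1 A) / a) * Complex.exp ((S A - L 2 A) / b))) =
        Complex.exp (T A) := by
      rw [← neg_mul, ← e3, ← Complex.exp_add, ← Complex.exp_add]; congr 1; simp only [T]; ring
    have k4 : A 4 * Complex.exp ((T A - L 4 A) / c) ^ c = Complex.exp (T A) := by
      rw [← e4, ← Complex.exp_nat_mul, ← Complex.exp_add]; congr 1; field_simp; ring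
    have k5 : A 5 * Complex.exp ((T A - L 5 A) / d) ^ d = Complex.exp (T A) := by
      rw [← e5, ← Complex.exp_nat_mul, ← Complex.exp_add]; congr 1; field_simp; ring
    rw [k0, k1, k2, k3, k4, k5]
    simp

/-! ### Reduction to the cusp equations -/

/-- The germ `vᵢ ↦ αᵢ(v) vᵢ + βᵢ(v) v_{τ i} ^ (eᵢ + 1)`, where `η = (α, β)`, has invertible
differential at `0` if all `αᵢ(0)` are nonzero and `β(0) = 0`. -/
theorem hasFDerivAt_diagonal {η : (Fin 4 → ℂ) → (Fin 4 → ℂ) × (Fin 4 → ℂ)}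
    (hη : AnalyticAt ℂ η 0) (hη2 : (η 0).2 = 0) (hη1 : ∀ i, (η 0).1 i ≠ 0)
    (τ : Fin 4 → Fin 4) (e : Fin 4 → ℕ) :
    ∃ φ' : (Fin 4 → ℂ) ≃L[ℂ] (Fin 4 → ℂ),
      HasFDerivAt (fun v i => (η v).1 i * v i + (η v).2 i * v (τ i) ^ (e i + 1))
        (φ' : (Fin 4 → ℂ) →L[ℂ] (Fin 4 → ℂ)) 0 := by
  refine ⟨ContinuousLinearEquiv.piCongrRight fun i =>
    ContinuousLinearEquiv.unitsEquivAut ℂ (Units.mk0 _ (hη1 i)), ?_⟩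
  refine hasFDerivAt_pi'.2 fun i => ?_
  have hd := hη.differentiableAt
  have h1 : DifferentiableAt ℂ (fun v => (η v).1 i) 0 := by fun_prop
  have h2 : DifferentiableAt ℂ (fun v => (η v).2 i) 0 := by fun_prop
  have h3 : HasFDerivAt (fun v : Fin 4 → ℂ => v i)
      (ContinuousLinearMap.proj i : (Fin 4 → ℂ) →L[ℂ] ℂ) 0 := hasFDerivAt_apply i 0
  have h4 : DifferentiableAt ℂ (fun v : Fin 4 → ℂ => v (τ i) ^ (e i + 1)) 0 := by fun_prop
  have := (h1.hasFDerivAt.mul h3).add (h2.hasFDerivAt.mul h4.hasFDerivAt)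
  refine this.congr_fderiv ?_
  ext v
  simp [hη2, mul_comm]

/-- A map germ both of whose components lie in the ideal generated by `x y`, `z w`, `x ^ γ₃`,
`y ^ γ₄`, `z ^ γ₁`, `w ^ γ₂` is contact equivalent to the cusp if, at the origin, the cofactors of
`x y, z ^ γ₁, w ^ γ₂` in the first component and of `z w, x ^ γ₃, y ^ γ₄` in the second one are
nonzero and all other cofactors vanish.

The substitution `x ↦ α₀ x + β₀ y ^ (γ₄ - 1)`, `y ↦ α₁ y + β₁ x ^ (γ₃ - 1)`,
`z ↦ α₂ z + β₂ w ^ (γ₂ - 1)`, `w ↦ α₃ w + β₃ z ^ (γ₁ - 1)` with analytic coefficients preserves this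
form. The result is a matrix times the cusp as soon as the new cofactors satisfy eight equations:
four of them scale the dominant cofactors and determine `α` by `exists_analyticAt_scaling`, the
other four determine `β` by division. Both sides of this system depend on `α` and `β` through the
substitution, but not at the origin, so `exists_analyticAt_fixedPoint` solves it. The case
`γ₃ = γ₄ = 2` is excluded because then the cofactor of `x y` in the second component at the origin
depends on `β` after the substitution. -/
theorem kEquivalent_cusp_of_cofactors {k l m n : ℕ} (hmn : m + n ≠ 0)
    (hdet : ((k + 2) + (l + 2)) * ((m + 2) + (n + 2)) ≠ (k + 2) * (l + 2) * (m + 2) * (n + 2))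
    {V P Q H R S W P' Q' H' R' S' : (Fin 4 → ℂ) → ℂ}
    (aV : ∀ v, AnalyticAt ℂ V v) (aP : ∀ v, AnalyticAt ℂ P v) (aQ : ∀ v, AnalyticAt ℂ Q v)
    (aH : ∀ v, AnalyticAt ℂ H v) (aR : ∀ v, AnalyticAt ℂ R v) (aS : ∀ v, AnalyticAt ℂ S v)
    (aW : ∀ v, AnalyticAt ℂ W v) (aP' : ∀ v, AnalyticAt ℂ P' v) (aQ' : ∀ v, AnalyticAt ℂ Q' v)
    (aH' : ∀ v, AnalyticAt ℂ H' v) (aR' : ∀ v, AnalyticAt ℂ R' v) (aS' : ∀ v, AnalyticAt ℂ S' v)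
    (hV : V 0 ≠ 0) (hR : R 0 ≠ 0) (hS : S 0 ≠ 0) (hW : W 0 ≠ 0) (hP' : P' 0 ≠ 0) (hQ' : Q' 0 ≠ 0)
    (hP : P 0 = 0) (hQ : Q 0 = 0) (hH : H 0 = 0) (hR' : R' 0 = 0) (hS' : S' 0 = 0) (hH' : H' 0 = 0)
    {F : (Fin 4 → ℂ) → (Fin 2 → ℂ)}
    (hF0 : ∀ v, F v 0 = (V v * (v 0 * v 1) + P v * v 0 ^ (m + 2) + Q v * v 1 ^ (n + 2))
      + (H v * (v 2 * v 3) + R v * v 2 ^ (k + 2) + S v * v 3 ^ (l + 2)))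
    (hF1 : ∀ v, F v 1 = (H' v * (v 0 * v 1) + P' v * v 0 ^ (m + 2) + Q' v * v 1 ^ (n + 2))
      + (W v * (v 2 * v 3) + R' v * v 2 ^ (k + 2) + S' v * v 3 ^ (l + 2))) :
    KEquivalent F (VirtualSing.cusp (k + 2) (l + 2) (m + 2) (n + 2)) := by
  set A₀ : Fin 6 → ℂ := ![V 0, R 0, S 0, W 0, P' 0, Q' 0] with hA₀
  have hA₀ne : ∀ i, A₀ i ≠ 0 := by intro i; fin_cases i <;> simpa [A₀]
  obtain ⟨σ, aσ, hσ, eσ⟩ := exists_analyticAt_scaling (by omega) (by omega) (by omega) (by omega)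
    hdet hA₀ne
  let q₀ : (Fin 4 → ℂ) × ((Fin 4 → ℂ) × (Fin 4 → ℂ)) := (0, (σ A₀, 0))
  obtain ⟨v, hv⟩ : ∃ v : Fin 4 → (Fin 4 → ℂ) × ((Fin 4 → ℂ) × (Fin 4 → ℂ)) → ℂ,
    ∀ i q, v i q = q.1 i := ⟨fun i q => q.1 i, fun _ _ => rfl⟩
  obtain ⟨α, hα⟩ : ∃ α : Fin 4 → (Fin 4 → ℂ) × ((Fin 4 → ℂ) × (Fin 4 → ℂ)) → ℂ,
    ∀ i q, α i q = q.2.1 i := ⟨fun i q => q.2.1 i, fun _ _ => rfl⟩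
  obtain ⟨β, hβ⟩ : ∃ β : Fin 4 → (Fin 4 → ℂ) × ((Fin 4 → ℂ) × (Fin 4 → ℂ)) → ℂ,
    ∀ i q, β i q = q.2.2 i := ⟨fun i q => q.2.2 i, fun _ _ => rfl⟩
  have av : ∀ i q, AnalyticAt ℂ (v i) q := by
    intro i q
    rw [show v i = fun q => q.1 i from funext (hv i)]
    exact ((ContinuousLinearMap.proj (R := ℂ) (φ := fun _ : Fin 4 => ℂ) i).comp
      (ContinuousLinearMap.fst ℂ _ _)).analyticAt q
  have aα : ∀ i q, AnalyticAt ℂ (α i) q := by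
    intro i q
    rw [show α i = fun q => q.2.1 i from funext (hα i)]
    exact ((ContinuousLinearMap.proj (R := ℂ) (φ := fun _ : Fin 4 => ℂ) i).comp
      ((ContinuousLinearMap.fst ℂ _ _).comp (ContinuousLinearMap.snd ℂ _ _))).analyticAt q
  have aβ : ∀ i q, AnalyticAt ℂ (β i) q := by
    intro i q
    rw [show β i = fun q => q.2.2 i from funext (hβ i)]
    exact ((ContinuousLinearMap.proj (R := ℂ) (φ := fun _ : Fin 4 => ℂ) i).comp
      ((ContinuousLinearMap.snd ℂ _ _).comp (ContinuousLinearMap.snd ℂ _ _))).analyticAt q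
  -- the substitution `φ`, as a map of the point `v` and the coefficients `α`, `β`
  let τ : Fin 4 → Fin 4 := ![1, 0, 3, 2]
  let e : Fin 4 → ℕ := ![n, m, l, k]
  let φ : (Fin 4 → ℂ) × ((Fin 4 → ℂ) × (Fin 4 → ℂ)) → Fin 4 → ℂ := fun q i =>
    α i q * v i q + β i q * v (τ i) q ^ (e i + 1)
  have aφ : ∀ q, AnalyticAt ℂ φ q := fun q => AnalyticAt.pi fun i => by fun_prop
  have comp : ∀ {G : (Fin 4 → ℂ) → ℂ}, (∀ v, AnalyticAt ℂ G v) →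
      ∃ G₁ : (Fin 4 → ℂ) × ((Fin 4 → ℂ) × (Fin 4 → ℂ)) → ℂ,
        (∀ q, AnalyticAt ℂ G₁ q) ∧ ∀ q, G₁ q = G (φ q) :=
    fun {G} hG => ⟨fun q => G (φ q), fun q => (hG _).fun_comp (aφ q), fun _ => rfl⟩
  obtain ⟨V₁, aV₁, eV⟩ := comp aV
  obtain ⟨P₁, aP₁, eP⟩ := comp aP
  obtain ⟨Q₁, aQ₁, eQ⟩ := comp aQ
  obtain ⟨H₁, aH₁, eH⟩ := comp aH
  obtain ⟨R₁, aR₁, eR⟩ := comp aR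
  obtain ⟨S₁, aS₁, eS⟩ := comp aS
  obtain ⟨W₁, aW₁, eW⟩ := comp aW
  obtain ⟨P₂, aP₂, eP'⟩ := comp aP'
  obtain ⟨Q₂, aQ₂, eQ'⟩ := comp aQ'
  obtain ⟨H₂, aH₂, eH'⟩ := comp aH'
  obtain ⟨R₂, aR₂, eR'⟩ := comp aR'
  obtain ⟨S₂, aS₂, eS'⟩ := comp aS'
  -- The coefficient equations, solved successively for the off-diagonal matrix entries `B₂₁`, `B₁₂`
  -- and for the `β i`, from the values of `α` and `β`.
  obtain ⟨B₂₁, eB₂₁⟩ : ∃ B : (Fin 4 → ℂ) × ((Fin 4 → ℂ) × (Fin 4 → ℂ)) → ℂ, ∀ q, B q =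
    crossCoeff m n (H₂ q) (P₂ q) (Q₂ q) (α 0 q) (β 0 q) (α 1 q) (β 1 q) (v 0 q) (v 1 q) :=
    ⟨_, fun _ => rfl⟩
  obtain ⟨b₂, eb₂⟩ : ∃ b : (Fin 4 → ℂ) × ((Fin 4 → ℂ) × (Fin 4 → ℂ)) → ℂ, ∀ q, b q =
    (-B₂₁ q - S₂ q * α 3 q ^ (l + 2) - R₂ q * (β 2 q ^ (k + 2) * v 3 q ^ (l * k + l + k)))
      / (W₁ q * α 3 q) := ⟨_, fun _ => rfl⟩
  obtain ⟨b₃, eb₃⟩ : ∃ b : (Fin 4 → ℂ) × ((Fin 4 → ℂ) × (Fin 4 → ℂ)) → ℂ, ∀ q, b q =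
    (-B₂₁ q - R₂ q * α 2 q ^ (k + 2) - S₂ q * (β 3 q ^ (l + 2) * v 2 q ^ (k * l + k + l)))
      / (W₁ q * α 2 q) := ⟨_, fun _ => rfl⟩
  obtain ⟨B₁₂, eB₁₂⟩ : ∃ B : (Fin 4 → ℂ) × ((Fin 4 → ℂ) × (Fin 4 → ℂ)) → ℂ, ∀ q, B q =
    -crossCoeff k l (H₁ q) (R₁ q) (S₁ q) (α 2 q) (b₂ q) (α 3 q) (b₃ q) (v 2 q) (v 3 q) :=
    ⟨_, fun _ => rfl⟩
  obtain ⟨b₀, eb₀⟩ : ∃ b : (Fin 4 → ℂ) × ((Fin 4 → ℂ) × (Fin 4 → ℂ)) → ℂ, ∀ q, b q =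
    (B₁₂ q - Q₁ q * α 1 q ^ (n + 2) - P₁ q * (β 0 q ^ (m + 2) * v 1 q ^ (n * m + n + m)))
      / (V₁ q * α 1 q) := ⟨_, fun _ => rfl⟩
  obtain ⟨b₁, eb₁⟩ : ∃ b : (Fin 4 → ℂ) × ((Fin 4 → ℂ) × (Fin 4 → ℂ)) → ℂ, ∀ q, b q =
    (B₁₂ q - P₁ q * α 0 q ^ (m + 2) - Q₁ q * (β 1 q ^ (n + 2) * v 0 q ^ (m * n + m + n)))
      / (V₁ q * α 0 q) := ⟨_, fun _ => rfl⟩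
  let A : (Fin 4 → ℂ) × ((Fin 4 → ℂ) × (Fin 4 → ℂ)) → Fin 6 → ℂ := fun q => ![
    crossCoeff m n (V₁ q) (P₁ q) (Q₁ q) (α 0 q) (b₀ q) (α 1 q) (b₁ q) (v 0 q) (v 1 q)
      / (α 0 q * α 1 q),
    sideCoeff k l (H₁ q) (R₁ q) (S₁ q) (α 2 q) (b₃ q) (v 2 q) / α 2 q ^ (k + 2),
    sideCoeff l k (H₁ q) (S₁ q) (R₁ q) (α 3 q) (b₂ q) (v 3 q) / α 3 q ^ (l + 2),
    crossCoeff k l (W₁ q) (R₂ q) (S₂ q) (α 2 q) (b₂ q) (α 3 q) (b₃ q) (v 2 q) (v 3 q)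
      / (α 2 q * α 3 q),
    sideCoeff m n (H₂ q) (P₂ q) (Q₂ q) (α 0 q) (b₁ q) (v 0 q) / α 0 q ^ (m + 2),
    sideCoeff n m (H₂ q) (Q₂ q) (P₂ q) (α 1 q) (b₀ q) (v 1 q) / α 1 q ^ (n + 2)]
  -- values at `v = 0`
  have z0 : ∀ y : (Fin 4 → ℂ) × (Fin 4 → ℂ), ∀ i, v i (0, y) = 0 := fun y i => by simp [hv]
  have zφ : ∀ y : (Fin 4 → ℂ) × (Fin 4 → ℂ), φ (0, y) = 0 := by
    intro y; ext i; simp [φ, z0]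
  have zB₂₁ : ∀ y, B₂₁ (0, y) = 0 := by
    intro y
    rw [eB₂₁, crossCoeff]
    simp only [z0, eH', zφ, hH']
    rcases Nat.eq_zero_or_pos n with hn | hn
    · have hm : m ≠ 0 := by omega
      simp [binomMid_zero_zero hm, hm]
    · rcases Nat.eq_zero_or_pos m with hm | hm
      · simp [binomMid_zero_zero hn.ne', hn.ne']
      · simp [hn.ne', hm.ne']
  have zb₂ : ∀ y, b₂ (0, y) = 0 := by
    intro y; rw [eb₂, zB₂₁, eS', eR', zφ, hR', hS']; simp
  have zb₃ : ∀ y, b₃ (0, y) = 0 := by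
    intro y; rw [eb₃, zB₂₁, eS', eR', zφ, hR', hS']; simp
  have zB₁₂ : ∀ y, B₁₂ (0, y) = 0 := by
    intro y; rw [eB₁₂, zb₂, zb₃, eH, zφ, hH]; simp [crossCoeff]
  have zb₀ : ∀ y, b₀ (0, y) = 0 := by
    intro y; rw [eb₀, zB₁₂, eP, eQ, zφ, hP, hQ]; simp
  have zb₁ : ∀ y, b₁ (0, y) = 0 := by
    intro y; rw [eb₁, zB₁₂, eP, eQ, zφ, hP, hQ]; simp
  have zA : ∀ y : (Fin 4 → ℂ) × (Fin 4 → ℂ), (∀ i, y.1 i ≠ 0) → A (0, y) = A₀ := by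
    intro y hy
    have hy' : ∀ i, α i (0, y) ≠ 0 := by simpa [hα] using hy
    have h0 := hy' 0
    have h1 := hy' 1
    have h2 := hy' 2
    have h3 := hy' 3
    simp only [A, A₀, zb₀, zb₁, zb₂, zb₃, crossCoeff, sideCoeff, eV, eR, eS, eW, eP', eQ', zφ]
    simp [h0, h1, h2, h3]
  -- analyticity
  have hα0 : ∀ i, α i q₀ ≠ 0 := fun i => by simpa [hα, q₀] using hσ A₀ i
  have hV0 : V₁ q₀ ≠ 0 := by rw [eV]; simpa only [q₀, zφ] using hV
  have hW0 : W₁ q₀ ≠ 0 := by rw [eW]; simpa only [q₀, zφ] using hW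
  have aB₂₁ : AnalyticAt ℂ B₂₁ q₀ := by
    rw [funext eB₂₁]; fun_prop
  have ab₂ : AnalyticAt ℂ b₂ q₀ := by
    rw [funext eb₂]
    exact AnalyticAt.fun_div (by fun_prop) (by fun_prop) (mul_ne_zero hW0 (hα0 3))
  have ab₃ : AnalyticAt ℂ b₃ q₀ := by
    rw [funext eb₃]
    exact AnalyticAt.fun_div (by fun_prop) (by fun_prop) (mul_ne_zero hW0 (hα0 2))
  have aB₁₂ : AnalyticAt ℂ B₁₂ q₀ := by
    rw [funext eB₁₂]; fun_prop
  have ab₀ : AnalyticAt ℂ b₀ q₀ := by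
    rw [funext eb₀]
    exact AnalyticAt.fun_div (by fun_prop) (by fun_prop) (mul_ne_zero hV0 (hα0 1))
  have ab₁ : AnalyticAt ℂ b₁ q₀ := by
    rw [funext eb₁]
    exact AnalyticAt.fun_div (by fun_prop) (by fun_prop) (mul_ne_zero hV0 (hα0 0))
  have aA : AnalyticAt ℂ A q₀ := by
    refine analyticAt_pi_iff (f := fun i q => A q i) |>.2 fun i => ?_
    fin_cases i
    · exact AnalyticAt.fun_div (by fun_prop) (by fun_prop) (mul_ne_zero (hα0 0) (hα0 1))
    · exact AnalyticAt.fun_div (by fun_prop) (by fun_prop) (pow_ne_zero _ (hα0 2))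
    · exact AnalyticAt.fun_div (by fun_prop) (by fun_prop) (pow_ne_zero _ (hα0 3))
    · exact AnalyticAt.fun_div (by fun_prop) (by fun_prop) (mul_ne_zero (hα0 2) (hα0 3))
    · exact AnalyticAt.fun_div (by fun_prop) (by fun_prop) (pow_ne_zero _ (hα0 0))
    · exact AnalyticAt.fun_div (by fun_prop) (by fun_prop) (pow_ne_zero _ (hα0 1))
  have hA0 : A q₀ = A₀ := zA _ (hσ A₀)
  let Ψ : (Fin 4 → ℂ) × ((Fin 4 → ℂ) × (Fin 4 → ℂ)) → (Fin 4 → ℂ) × (Fin 4 → ℂ) := fun q =>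
    (σ (A q), fun i => (![b₀, b₁, b₂, b₃] : Fin 4 → _ → ℂ) i q)
  have aΨ : AnalyticAt ℂ Ψ q₀ := by
    refine AnalyticAt.prod ?_ (AnalyticAt.pi fun i => ?_)
    · exact AnalyticAt.fun_comp (g := σ) (by rwa [hA0]) aA
    · fin_cases i <;> assumption
  have zΨ : ∀ᶠ y in 𝓝 (σ A₀, (0 : Fin 4 → ℂ)), Ψ (0, y) = (σ A₀, 0) := by
    have : ∀ᶠ y : (Fin 4 → ℂ) × (Fin 4 → ℂ) in 𝓝 (σ A₀, 0), ∀ i, y.1 i ≠ 0 :=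
      Filter.eventually_all.2 fun i =>
        ((continuous_apply i).comp continuous_fst).continuousAt.eventually_ne (hσ A₀ i)
    filter_upwards [this] with y hy
    refine Prod.ext ?_ (funext fun i => ?_)
    · simp only [Ψ, zA y hy]
    · fin_cases i <;> simp [Ψ, zb₀, zb₁, zb₂, zb₃]
  obtain ⟨η, aη, hη0, hη⟩ := exists_analyticAt_fixedPoint aΨ zΨ
  have aη' : AnalyticAt ℂ (fun u => (u, η u)) 0 := analyticAt_id.prod aη
  have hq0 : ((0, η 0) : (Fin 4 → ℂ) × ((Fin 4 → ℂ) × (Fin 4 → ℂ))) = q₀ := by rw [hη0]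
  have onη : ∀ {G : (Fin 4 → ℂ) × ((Fin 4 → ℂ) × (Fin 4 → ℂ)) → ℂ}, AnalyticAt ℂ G q₀ →
      AnalyticAt ℂ (fun u => G (u, η u)) 0 := fun {G} hG =>
    AnalyticAt.fun_comp (g := G) (by rwa [hq0]) aη'
  obtain ⟨φ', hφ'⟩ := hasFDerivAt_diagonal aη (by rw [hη0]) (by rw [hη0]; exact hσ A₀) τ e
  have hφ'' : HasFDerivAt (fun u => φ (u, η u)) (φ' : (Fin 4 → ℂ) →L[ℂ] (Fin 4 → ℂ)) 0 := by
    simpa only [φ, hα, hβ, hv] using hφ'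
  let M : (Fin 4 → ℂ) × ((Fin 4 → ℂ) × (Fin 4 → ℂ)) → Matrix (Fin 2) (Fin 2) ℂ := fun q =>
    !![crossCoeff m n (V₁ q) (P₁ q) (Q₁ q) (α 0 q) (b₀ q) (α 1 q) (b₁ q) (v 0 q) (v 1 q), B₁₂ q;
      B₂₁ q, sideCoeff m n (H₂ q) (P₂ q) (Q₂ q) (α 0 q) (b₁ q) (v 0 q)]
  refine KEquivalent.of_coordinates (φ := fun u => φ (u, η u)) (A := fun u => M (u, η u))
    ((aφ _).fun_comp aη') (zφ _) hφ'' ?_ ?_ ?_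
  · intro i j
    fin_cases i <;> fin_cases j
    · exact onη (G := fun q => crossCoeff m n (V₁ q) (P₁ q) (Q₁ q) (α 0 q) (b₀ q) (α 1 q) (b₁ q)
        (v 0 q) (v 1 q)) (by fun_prop)
    · exact onη aB₁₂
    · exact onη aB₂₁
    · exact onη (G := fun q => sideCoeff m n (H₂ q) (P₂ q) (Q₂ q) (α 0 q) (b₁ q) (v 0 q))
        (by fun_prop)
  · have h0 := hσ A₀ 0
    have h1 := hσ A₀ 1
    simp [hη0, M, zb₀, zb₁, zB₁₂, crossCoeff, sideCoeff, eV, eP', zφ, hα, hV, hP', h0, h1]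
  · have hAη : Filter.Tendsto (fun u => A (u, η u)) (𝓝 0) (𝓝 A₀) := by
      have : AnalyticAt ℂ (fun u => A (u, η u)) 0 :=
        AnalyticAt.fun_comp (g := A) (by rwa [hq0]) aη'
      have := this.continuousAt.tendsto
      rwa [hq0, hA0] at this
    have hVη : ∀ᶠ u in 𝓝 0, V₁ (u, η u) ≠ 0 :=
      (onη (aV₁ _)).continuousAt.eventually_ne (by rwa [hq0])
    have hWη : ∀ᶠ u in 𝓝 0, W₁ (u, η u) ≠ 0 :=
      (onη (aW₁ _)).continuousAt.eventually_ne (by rwa [hq0])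
    filter_upwards [hη, hAη.eventually eσ, hVη, hWη] with u hu hs hVu hWu
    generalize hq : (u, η u) = q at hu hs hVu hWu ⊢
    have hu1 : ∀ i, σ (A q) i = α i q := by
      intro i
      rw [hα, show q.2 = η u by rw [← hq]]
      exact congrFun (congrArg Prod.fst hu) i
    have hu2 : ∀ i, (![b₀, b₁, b₂, b₃] : Fin 4 → _ → ℂ) i q = β i q := by
      intro i
      rw [hβ, show q.2 = η u by rw [← hq]]
      exact congrFun (congrArg Prod.snd hu) i
    have hb₀ : b₀ q = β 0 q := hu2 0
    have hb₁ : b₁ q = β 1 q := hu2 1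
    have hb₂ : b₂ q = β 2 q := hu2 2
    have hb₃ : b₃ q = β 3 q := hu2 3
    have hn : ∀ i, α i q ≠ 0 := fun i => by rw [← hu1]; exact hσ _ i
    have n0 := hn 0
    have n1 := hn 1
    have n2 := hn 2
    have n3 := hn 3
    have c₂ := eb₂ q
    have c₃ := eb₃ q
    have c₀ := eb₀ q
    have c₁ := eb₁ q
    have cB₂₁ := eB₂₁ q
    have cB₁₂ := eB₁₂ q
    rw [eq_div_iff (mul_ne_zero hWu n3)] at c₂
    rw [eq_div_iff (mul_ne_zero hWu n2)] at c₃
    rw [eq_div_iff (mul_ne_zero hVu n1)] at c₀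
    rw [eq_div_iff (mul_ne_zero hVu n0)] at c₁
    simp only [hu1] at hs
    simp only [A, hb₀, hb₁, hb₂, hb₃] at hs
    simp only [hb₀, hb₁, hb₂, hb₃] at c₀ c₁ c₂ c₃ cB₁₂
    obtain ⟨s1, s2, s3, s4⟩ := hs
    simp only [Matrix.cons_val] at s1 s2 s3 s4
    rw [div_mul_cancel₀ _ (mul_ne_zero n0 n1), div_mul_cancel₀ _ (pow_ne_zero _ n2)] at s1
    rw [div_mul_cancel₀ _ (mul_ne_zero n0 n1), div_mul_cancel₀ _ (pow_ne_zero _ n3)] at s2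
    rw [div_mul_cancel₀ _ (mul_ne_zero n2 n3), div_mul_cancel₀ _ (pow_ne_zero _ n0)] at s3
    rw [div_mul_cancel₀ _ (mul_ne_zero n2 n3), div_mul_cancel₀ _ (pow_ne_zero _ n1)] at s4
    have t₂ : sideCoeff l k (W₁ q) (S₂ q) (R₂ q) (α 3 q) (β 2 q) (v 3 q) = -B₂₁ q := by
      rw [sideCoeff]; linear_combination c₂
    have t₃ : sideCoeff k l (W₁ q) (R₂ q) (S₂ q) (α 2 q) (β 3 q) (v 2 q) = -B₂₁ q := by
      rw [sideCoeff]; linear_combination c₃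
    have t₀ : sideCoeff n m (V₁ q) (Q₁ q) (P₁ q) (α 1 q) (β 0 q) (v 1 q) = B₁₂ q := by
      rw [sideCoeff]; linear_combination c₀
    have t₁ : sideCoeff m n (V₁ q) (P₁ q) (Q₁ q) (α 0 q) (β 1 q) (v 0 q) = B₁₂ q := by
      rw [sideCoeff]; linear_combination c₁
    have i1 := substitution_identity m n (V₁ q) (P₁ q) (Q₁ q) (α 0 q) (β 0 q) (α 1 q) (β 1 q)
      (v 0 q) (v 1 q)
    have i2 := substitution_identity k l (H₁ q) (R₁ q) (S₁ q) (α 2 q) (β 2 q) (α 3 q) (β 3 q)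
      (v 2 q) (v 3 q)
    have i3 := substitution_identity m n (H₂ q) (P₂ q) (Q₂ q) (α 0 q) (β 0 q) (α 1 q) (β 1 q)
      (v 0 q) (v 1 q)
    have i4 := substitution_identity k l (W₁ q) (R₂ q) (S₂ q) (α 2 q) (β 2 q) (α 3 q) (β 3 q)
      (v 2 q) (v 3 q)
    have hvu : ∀ i, u i = v i q := by intro i; rw [hv, ← hq]
    ext i
    fin_cases i
    · change F (φ q) 0 = _
      rw [hF0, ← eV, ← eP, ← eQ, ← eH, ← eR, ← eS]
      simp [M, VirtualSing.cusp, pairMap, Matrix.mulVec, dotProduct, Fin.sum_univ_two, hvu, hb₀,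
        hb₁, φ, τ, e]
      rw [t₀, t₁] at i1
      linear_combination i1 + i2 + (v 2 q * v 3 q) * cB₁₂ + (v 2 q ^ (k + 2)) * s1
        + (v 3 q ^ (l + 2)) * s2
    · change F (φ q) 1 = _
      rw [hF1, ← eW, ← eP', ← eQ', ← eH', ← eR', ← eS']
      simp [M, VirtualSing.cusp, pairMap, Matrix.mulVec, dotProduct, Fin.sum_univ_two, hvu, hb₀,
        hb₁, φ, τ, e]
      rw [t₂, t₃] at i4
      linear_combination i3 + i4 - (v 0 q * v 1 q) * cB₂₁ - (v 2 q * v 3 q) * s3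
        + (v 1 q ^ (n + 2)) * (s3 - s4)

/-! ### A criterion in terms of coordinate planes -/

open MvPolynomial in
/-- If `x y = 0` and `z w = 0`, the value of a polynomial at `(x, y, z, w)` is the alternating sum
of its values on the coordinate planes `(x, z)`, `(x, w)`, `(y, z)`, `(y, w)`, on the coordinate
axes and at the origin. -/
theorem MvPolynomial.aeval_eq_sum_planes {A : Type*} [CommRing A] [Algebra ℂ A] {x y z w : A}
    (hxy : x * y = 0) (hzw : z * w = 0) (h : MvPolynomial (Fin 4) ℂ) :
    aeval ![x, y, z, w] h = aeval ![x, 0, z, 0] h + aeval ![x, 0, 0, w] h + aeval ![0, y, z, 0] h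
      + aeval ![0, y, 0, w] h - aeval ![x, 0, 0, 0] h - aeval ![0, y, 0, 0] h
      - aeval ![0, 0, z, 0] h - aeval ![0, 0, 0, w] h + aeval ![0, 0, 0, 0] h := by
  induction h using MvPolynomial.induction_on' with
  | monomial e a =>
    simp only [aeval_monomial, Finsupp.prod_fintype _ _ (fun i => pow_zero _), Fin.prod_univ_four,
      Matrix.cons_val]
    have k1 : ∀ i j : ℕ, x ^ (i + 1) * y ^ (j + 1) = 0 := fun i j => by
      rw [pow_succ, pow_succ]; linear_combination x ^ i * y ^ j * hxy
    have k2 : ∀ i j : ℕ, z ^ (i + 1) * w ^ (j + 1) = 0 := fun i j => by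
      rw [pow_succ, pow_succ]; linear_combination z ^ i * w ^ j * hzw
    rcases e 0 with _ | e0 <;> rcases e 1 with _ | e1 <;> rcases e 2 with _ | e2 <;>
      rcases e 3 with _ | e3 <;> simp [k1, k2, mul_assoc]
  | add p q hp hq =>
    simp only [map_add, hp, hq]
    ring

/-- The condition that `h = v x y + w z w + p x ^ c + q y ^ d + r z ^ a + s w ^ b`, up to terms in
`𝔪 · (x y, z w, x ^ c, y ^ d, z ^ a, w ^ b)`, expressed through the values of `h` on coordinate
planes, on axes and on two diagonals, with truncations encoded by nilpotent elements of arbitrary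
`ℂ`-algebras. -/
structure HasCuspShape (a b c d : ℕ) (v w p q r s : ℂ) (h : MvPolynomial (Fin 4) ℂ) : Prop where
  planeXZ : ∀ {A : Type} [CommRing A] [Algebra ℂ A] (σ τ : A), σ ^ c = 0 → τ ^ a = 0 →
    MvPolynomial.aeval ![σ, 0, τ, 0] h = 0
  planeXW : ∀ {A : Type} [CommRing A] [Algebra ℂ A] (σ τ : A), σ ^ c = 0 → τ ^ b = 0 →
    MvPolynomial.aeval ![σ, 0, 0, τ] h = 0
  planeYZ : ∀ {A : Type} [CommRing A] [Algebra ℂ A] (σ τ : A), σ ^ d = 0 → τ ^ a = 0 →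
    MvPolynomial.aeval ![0, σ, τ, 0] h = 0
  planeYW : ∀ {A : Type} [CommRing A] [Algebra ℂ A] (σ τ : A), σ ^ d = 0 → τ ^ b = 0 →
    MvPolynomial.aeval ![0, σ, 0, τ] h = 0
  axisX : ∀ {A : Type} [CommRing A] [Algebra ℂ A] (σ : A), σ ^ (c + 1) = 0 →
    MvPolynomial.aeval ![σ, 0, 0, 0] h = algebraMap ℂ A p * σ ^ c
  axisY : ∀ {A : Type} [CommRing A] [Algebra ℂ A] (σ : A), σ ^ (d + 1) = 0 →
    MvPolynomial.aeval ![0, σ, 0, 0] h = algebraMap ℂ A q * σ ^ d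
  axisZ : ∀ {A : Type} [CommRing A] [Algebra ℂ A] (σ : A), σ ^ (a + 1) = 0 →
    MvPolynomial.aeval ![0, 0, σ, 0] h = algebraMap ℂ A r * σ ^ a
  axisW : ∀ {A : Type} [CommRing A] [Algebra ℂ A] (σ : A), σ ^ (b + 1) = 0 →
    MvPolynomial.aeval ![0, 0, 0, σ] h = algebraMap ℂ A s * σ ^ b
  diagXY : ∀ {A : Type} [CommRing A] [Algebra ℂ A] (σ : A), σ ^ 3 = 0 →
    MvPolynomial.aeval ![σ, σ, 0, 0] h =
      algebraMap ℂ A v * σ ^ 2 + algebraMap ℂ A p * σ ^ c + algebraMap ℂ A q * σ ^ d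
  diagZW : ∀ {A : Type} [CommRing A] [Algebra ℂ A] (σ : A), σ ^ 3 = 0 →
    MvPolynomial.aeval ![0, 0, σ, σ] h =
      algebraMap ℂ A w * σ ^ 2 + algebraMap ℂ A r * σ ^ a + algebraMap ℂ A s * σ ^ b

/-- An identity for a polynomial in every algebra with a nilpotent element is a divisibility in
the polynomial ring in one variable. -/
theorem Polynomial.X_pow_dvd_of_forall_algebra {N : ℕ} {h : MvPolynomial (Fin 4) ℂ}
    (e : Fin 4 → Polynomial ℂ) (G : Polynomial ℂ)
    (H : ∀ {A : Type} [CommRing A] [Algebra ℂ A] (σ : A), σ ^ N = 0 →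
      MvPolynomial.aeval (fun i => aeval σ (e i)) h = aeval σ G) :
    (X : Polynomial ℂ) ^ N ∣ MvPolynomial.aeval e h - G := by
  let I : Ideal (Polynomial ℂ) := Ideal.span {X ^ N}
  have h1 := H (Ideal.Quotient.mk I X) (by
    rw [← map_pow, Ideal.Quotient.eq_zero_iff_mem]; exact Ideal.subset_span rfl)
  have h2 : ∀ p : Polynomial ℂ, aeval (Ideal.Quotient.mk I X) p = Ideal.Quotient.mkₐ ℂ I p := by
    intro p
    rw [show Ideal.Quotient.mk I X = Ideal.Quotient.mkₐ ℂ I X from rfl, aeval_algHom_apply,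
      aeval_X_left_apply]
  simp only [h2] at h1
  rw [← MvPolynomial.comp_aeval_apply, ← sub_eq_zero, ← map_sub, Ideal.Quotient.mkₐ_eq_mk,
    Ideal.Quotient.eq_zero_iff_mem, Ideal.mem_span_singleton] at h1
  exact h1

theorem Polynomial.eval_zero_eq_of_dvd {N : ℕ} {p : Polynomial ℂ} {a : ℂ}
    (h : (X : Polynomial ℂ) ^ (N + 1) ∣ (p - C a) * X ^ N) : p.eval 0 = a := by
  obtain ⟨q, hq⟩ := h
  have h1 : p - C a = X * q :=
    mul_right_cancel₀ (pow_ne_zero N X_ne_zero) (by rw [hq]; ring)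
  have := congrArg (eval 0) h1
  simpa [sub_eq_zero] using this

open MvPolynomial in
/-- The planes give membership in the ideal, the axes and diagonals give the values of the
cofactors at the origin. -/
theorem HasCuspShape.exists_cofactors {a b c d : ℕ} (ha : 2 ≤ a) (hb : 2 ≤ b) (hc : 2 ≤ c)
    (hd : 2 ≤ d) {v w p q r s : ℂ} {h : MvPolynomial (Fin 4) ℂ}
    (H : HasCuspShape a b c d v w p q r s h) :
    ∃ V W P Q R S : MvPolynomial (Fin 4) ℂ,
      h = (V * (X 0 * X 1) + P * X 0 ^ c + Q * X 1 ^ d)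
        + (W * (X 2 * X 3) + R * X 2 ^ a + S * X 3 ^ b) ∧
      eval 0 V = v ∧ eval 0 W = w ∧ eval 0 P = p ∧ eval 0 Q = q ∧ eval 0 R = r ∧ eval 0 S = s := by
  obtain ⟨V, P, Q, W, R, S, hh⟩ : ∃ V P Q W R S : MvPolynomial (Fin 4) ℂ,
      h = (V * (X 0 * X 1) + P * X 0 ^ c + Q * X 1 ^ d)
        + (W * (X 2 * X 3) + R * X 2 ^ a + S * X 3 ^ b) := by
    let I : Ideal (MvPolynomial (Fin 4) ℂ) :=
      Ideal.span {X 0 * X 1, X 0 ^ c, X 1 ^ d, X 2 * X 3, X 2 ^ a, X 3 ^ b}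
    have hI : ∀ g ∈ ({X 0 * X 1, X 0 ^ c, X 1 ^ d, X 2 * X 3, X 2 ^ a, X 3 ^ b} :
        Set (MvPolynomial (Fin 4) ℂ)), Ideal.Quotient.mkₐ ℂ I g = 0 := fun g hg =>
      Ideal.Quotient.eq_zero_iff_mem.2 (Ideal.subset_span hg)
    let π := Ideal.Quotient.mkₐ ℂ I
    have e1 : π (X 0) * π (X 1) = 0 := by rw [← map_mul]; exact hI _ (by simp)
    have e2 : π (X 2) * π (X 3) = 0 := by rw [← map_mul]; exact hI _ (by simp)
    have e3 : π (X 0) ^ c = 0 := by rw [← map_pow]; exact hI _ (by simp)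
    have e4 : π (X 1) ^ d = 0 := by rw [← map_pow]; exact hI _ (by simp)
    have e5 : π (X 2) ^ a = 0 := by rw [← map_pow]; exact hI _ (by simp)
    have e6 : π (X 3) ^ b = 0 := by rw [← map_pow]; exact hI _ (by simp)
    have z0 : ∀ {N : ℕ}, 2 ≤ N → (0 : MvPolynomial (Fin 4) ℂ ⧸ I) ^ N = 0 := fun hN =>
      zero_pow (by omega)
    have hmem : π h = 0 := by
      have : π h = aeval ![π (X 0), π (X 1), π (X 2), π (X 3)] h := by
        have hX : aeval (X : Fin 4 → MvPolynomial (Fin 4) ℂ) h = h := aeval_X_left_apply h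
        conv_lhs => rw [← hX, comp_aeval_apply]
        congr 2
        ext i
        fin_cases i <;> rfl
      rw [this, aeval_eq_sum_planes e1 e2, H.planeXZ _ _ e3 e5, H.planeXW _ _ e3 e6,
        H.planeYZ _ _ e4 e5, H.planeYW _ _ e4 e6, H.planeXZ _ 0 e3 (z0 ha),
        H.planeYZ _ 0 e4 (z0 ha), H.planeXZ 0 _ (z0 hc) e5,
        H.planeXW 0 _ (z0 hc) e6, H.planeXZ 0 0 (z0 hc) (z0 ha)]
      simp
    have := Ideal.Quotient.eq_zero_iff_mem.1 hmem
    simp only [I, Ideal.mem_span_insert, Ideal.mem_span_singleton'] at this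
    obtain ⟨V, _, ⟨P, _, ⟨Q, _, ⟨W, _, ⟨R, _, ⟨S, rfl⟩, rfl⟩, rfl⟩, rfl⟩, rfl⟩, rfl⟩ := this
    exact ⟨V, P, Q, W, R, S, by ring⟩
  have ev : ∀ (e : Fin 4 → Polynomial ℂ) (g : MvPolynomial (Fin 4) ℂ), (∀ i, (e i).eval 0 = 0) →
      (aeval e g : Polynomial ℂ).eval 0 = eval 0 g := by
    intro e g he
    rw [← Polynomial.coe_aeval_eq_eval, comp_aeval_apply, ← coe_aeval_eq_eval]
    simp only [Polynomial.coe_aeval_eq_eval, he]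
    rfl
  have z0 : ∀ {N : ℕ}, 2 ≤ N → (0 : Polynomial ℂ) ^ N = 0 := fun hN => zero_pow (by omega)
  have hP : eval 0 P = p := by
    have h1 := Polynomial.X_pow_dvd_of_forall_algebra (h := h) (N := c + 1)
      ![Polynomial.X, 0, 0, 0] (Polynomial.C p * Polynomial.X ^ c) (fun {A} _ _ σ hσ => by
        rw [← show _ = _ from (congrArg (fun e => aeval e h) (funext fun i => by
          fin_cases i <;> simp : ![σ, 0, 0, 0] = fun i => Polynomial.aeval σ _)), H.axisX σ hσ]
        simp)
    rw [hh] at h1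
    simp [z0, ha, hb, hd, ← sub_mul] at h1
    rw [← Polynomial.eval_zero_eq_of_dvd h1, ev]
    intro i; fin_cases i <;> simp
  have hQ : eval 0 Q = q := by
    have h1 := Polynomial.X_pow_dvd_of_forall_algebra (h := h) (N := d + 1)
      ![0, Polynomial.X, 0, 0] (Polynomial.C q * Polynomial.X ^ d) (fun {A} _ _ σ hσ => by
        rw [← show _ = _ from (congrArg (fun e => aeval e h) (funext fun i => by
          fin_cases i <;> simp : ![0, σ, 0, 0] = fun i => Polynomial.aeval σ _)), H.axisY σ hσ]
        simp)
    rw [hh] at h1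
    simp [z0, ha, hb, hc, ← sub_mul] at h1
    rw [← Polynomial.eval_zero_eq_of_dvd h1, ev]
    intro i; fin_cases i <;> simp
  have hR : eval 0 R = r := by
    have h1 := Polynomial.X_pow_dvd_of_forall_algebra (h := h) (N := a + 1)
      ![0, 0, Polynomial.X, 0] (Polynomial.C r * Polynomial.X ^ a) (fun {A} _ _ σ hσ => by
        rw [← show _ = _ from (congrArg (fun e => aeval e h) (funext fun i => by
          fin_cases i <;> simp : ![0, 0, σ, 0] = fun i => Polynomial.aeval σ _)), H.axisZ σ hσ]
        simp)
    rw [hh] at h1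
    simp [z0, hb, hc, hd, ← sub_mul] at h1
    rw [← Polynomial.eval_zero_eq_of_dvd h1, ev]
    intro i; fin_cases i <;> simp
  have hS : eval 0 S = s := by
    have h1 := Polynomial.X_pow_dvd_of_forall_algebra (h := h) (N := b + 1)
      ![0, 0, 0, Polynomial.X] (Polynomial.C s * Polynomial.X ^ b) (fun {A} _ _ σ hσ => by
        rw [← show _ = _ from (congrArg (fun e => aeval e h) (funext fun i => by
          fin_cases i <;> simp : ![0, 0, 0, σ] = fun i => Polynomial.aeval σ _)), H.axisW σ hσ]
        simp)
    rw [hh] at h1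
    simp [z0, ha, hc, hd, ← sub_mul] at h1
    rw [← Polynomial.eval_zero_eq_of_dvd h1, ev]
    intro i; fin_cases i <;> simp
  have pdvd : ∀ {g : Polynomial ℂ} {k : ℂ} {t : ℂ} {N : ℕ}, 2 ≤ N → g.eval 0 = t → t = k →
      (Polynomial.X : Polynomial ℂ) ^ 3 ∣ (g - Polynomial.C k) * Polynomial.X ^ N := by
    intro g k t N hN hg hk
    have h1 : (Polynomial.X : Polynomial ℂ) ∣ g - Polynomial.C k := by
      rw [Polynomial.X_dvd_iff, Polynomial.coeff_zero_eq_eval_zero]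
      simp [hg, hk]
    have h2 : (Polynomial.X : Polynomial ℂ) ^ 2 ∣ (Polynomial.X : Polynomial ℂ) ^ N :=
      pow_dvd_pow _ hN
    exact (by ring : (Polynomial.X : Polynomial ℂ) ^ 3 = Polynomial.X * Polynomial.X ^ 2) ▸
      mul_dvd_mul h1 h2
  have hV : eval 0 V = v := by
    have h1 := Polynomial.X_pow_dvd_of_forall_algebra (h := h) (N := 3)
      ![Polynomial.X, Polynomial.X, 0, 0] (Polynomial.C v * Polynomial.X ^ 2
        + Polynomial.C p * Polynomial.X ^ c + Polynomial.C q * Polynomial.X ^ d)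
      (fun {A} _ _ σ hσ => by
        rw [← show _ = _ from (congrArg (fun e => aeval e h) (funext fun i => by
          fin_cases i <;> simp : ![σ, σ, 0, 0] = fun i => Polynomial.aeval σ _)), H.diagXY σ hσ]
        simp)
    have he : ∀ i, Polynomial.eval 0
        ((![Polynomial.X, Polynomial.X, 0, 0] : Fin 4 → Polynomial ℂ) i) = 0 := by
      intro i; fin_cases i <;> simp
    rw [hh] at h1
    simp [z0, ha, hb] at h1
    generalize (![Polynomial.X, Polynomial.X, 0, 0] : Fin 4 → Polynomial ℂ) = e at h1 he
    have dP := pdvd (g := aeval e P) hc (ev e P he) hP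
    have dQ := pdvd (g := aeval e Q) hd (ev e Q he) hQ
    have h2 : (Polynomial.X : Polynomial ℂ) ^ (2 + 1) ∣
        ((aeval e V : Polynomial ℂ) - Polynomial.C v) * Polynomial.X ^ 2 := by
      convert dvd_sub (dvd_sub h1 dP) dQ using 1
      ring
    rw [← Polynomial.eval_zero_eq_of_dvd h2, ev e V he]
  have hW : eval 0 W = w := by
    have h1 := Polynomial.X_pow_dvd_of_forall_algebra (h := h) (N := 3)
      ![0, 0, Polynomial.X, Polynomial.X] (Polynomial.C w * Polynomial.X ^ 2
        + Polynomial.C r * Polynomial.X ^ a + Polynomial.C s * Polynomial.X ^ b)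
      (fun {A} _ _ σ hσ => by
        rw [← show _ = _ from (congrArg (fun e => aeval e h) (funext fun i => by
          fin_cases i <;> simp : ![0, 0, σ, σ] = fun i => Polynomial.aeval σ _)), H.diagZW σ hσ]
        simp)
    have he : ∀ i, Polynomial.eval 0
        ((![0, 0, Polynomial.X, Polynomial.X] : Fin 4 → Polynomial ℂ) i) = 0 := by
      intro i; fin_cases i <;> simp
    rw [hh] at h1
    simp [z0, hc, hd] at h1
    generalize (![0, 0, Polynomial.X, Polynomial.X] : Fin 4 → Polynomial ℂ) = e at h1 he
    have dP := pdvd (g := aeval e R) ha (ev e R he) hR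
    have dQ := pdvd (g := aeval e S) hb (ev e S he) hS
    have h2 : (Polynomial.X : Polynomial ℂ) ^ (2 + 1) ∣
        ((aeval e W : Polynomial ℂ) - Polynomial.C w) * Polynomial.X ^ 2 := by
      convert dvd_sub (dvd_sub h1 dP) dQ using 1
      ring
    rw [← Polynomial.eval_zero_eq_of_dvd h2, ev e W he]
  exact ⟨V, W, P, Q, R, S, hh, hV, hW, hP, hQ, hR, hS⟩

open MvPolynomial in
/-- The form of `kEquivalent_cusp_of_cofactors` that can be checked on explicit polynomials. -/
theorem kEquivalent_cusp_of_hasCuspShape {a b c d : ℕ} (ha : 2 ≤ a) (hb : 2 ≤ b) (hc : 2 ≤ c)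
    (hd : 2 ≤ d) (hcd : 4 < c + d) (hdet : (a + b) * (c + d) ≠ a * b * c * d)
    {f g : MvPolynomial (Fin 4) ℂ} {v r s w p q : ℂ} (hf : HasCuspShape a b c d v 0 0 0 r s f)
    (hg : HasCuspShape a b c d 0 w p q 0 0 g) (hv : v ≠ 0) (hr : r ≠ 0) (hs : s ≠ 0) (hw : w ≠ 0)
    (hp : p ≠ 0) (hq : q ≠ 0) : KEquivalent (pairMap f g) (VirtualSing.cusp a b c d) := by
  obtain ⟨V, H, P, Q, R, S, ef, hV, hH, hP, hQ, hR, hS⟩ := hf.exists_cofactors ha hb hc hd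
  obtain ⟨H', W, P', Q', R', S', eg, hH', hW, hP', hQ', hR', hS'⟩ :=
    hg.exists_cofactors ha hb hc hd
  obtain ⟨k, rfl⟩ := Nat.exists_eq_add_of_le' ha
  obtain ⟨l, rfl⟩ := Nat.exists_eq_add_of_le' hb
  obtain ⟨m, rfl⟩ := Nat.exists_eq_add_of_le' hc
  obtain ⟨n, rfl⟩ := Nat.exists_eq_add_of_le' hd
  have an : ∀ (G : MvPolynomial (Fin 4) ℂ) (u : Fin 4 → ℂ),
      AnalyticAt ℂ (fun u => eval u G) u := fun G u =>
    AnalyticOnNhd.eval_mvPolynomial G u (Set.mem_univ u)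
  refine kEquivalent_cusp_of_cofactors (by omega) hdet (an V) (an P) (an Q) (an H) (an R) (an S)
    (an W) (an P') (an Q') (an H') (an R') (an S') (by rwa [hV]) (by rwa [hR]) (by rwa [hS])
    (by rwa [hW]) (by rwa [hP']) (by rwa [hQ']) hP hQ hH hR' hS' hH' ?_ ?_
  · intro u
    simp [pairMap, ef]
  · intro u
    simp [pairMap, eg]

/-! ### Polynomial coordinate changes -/

open Polynomial in
/-- A polynomial whose restrictions to the coordinate axes vanish to second order has zero
differential at the origin. -/
theorem MvPolynomial.hasFDerivAt_eval_zero {p : MvPolynomial (Fin 4) ℂ}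
    (hp : ∀ (j : Fin 4) {A : Type} [CommRing A] [Algebra ℂ A] (ε : A), ε ^ 2 = 0 →
      aeval (Pi.single j ε : Fin 4 → A) p = 0) :
    HasFDerivAt (fun v => eval v p) (0 : (Fin 4 → ℂ) →L[ℂ] ℂ) 0 := by
  have hd : DifferentiableAt ℂ (fun v => eval v p) (0 : Fin 4 → ℂ) :=
    (AnalyticOnNhd.eval_mvPolynomial p 0 (Set.mem_univ _)).differentiableAt
  refine hd.hasFDerivAt.congr_fderiv (ContinuousLinearMap.coe_injective (LinearMap.pi_ext' ?_))
  intro j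
  ext
  let e : Fin 4 → ℂ[X] := Pi.single j Polynomial.X
  have hdvd := Polynomial.X_pow_dvd_of_forall_algebra (N := 2) (h := p) e 0 fun {A} _ _ σ hσ => by
    rw [map_zero, ← hp j σ hσ]
    congr 2
    ext i
    rcases eq_or_ne i j with rfl | hij
    · simp [e]
    · simp [e, hij]
  obtain ⟨q, hq⟩ := hdvd
  have hline : ∀ t : ℂ, eval (t • (Pi.single j 1 : Fin 4 → ℂ)) p = t ^ 2 * q.eval t := by
    intro t
    have h1 := congrArg (Polynomial.aeval t) hq
    rw [sub_zero, comp_aeval_apply] at h1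
    have h2 : (fun i => Polynomial.aeval t (e i)) = t • (Pi.single j 1 : Fin 4 → ℂ) := by
      ext i
      rcases eq_or_ne i j with rfl | hij
      · simp [e]
      · simp [e, hij]
    rw [h2] at h1
    simpa [coe_aeval_eq_eval, Polynomial.coe_aeval_eq_eval] using h1
  have h1 : HasDerivAt (fun t : ℂ => eval (t • (Pi.single j 1 : Fin 4 → ℂ)) p)
      (fderiv ℂ (fun v => eval v p) 0 (Pi.single j 1)) 0 := by
    have hl : HasDerivAt (fun t : ℂ => t • (Pi.single j 1 : Fin 4 → ℂ)) (Pi.single j 1) 0 := by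
      simpa using (hasDerivAt_id (0 : ℂ)).smul_const (Pi.single j 1 : Fin 4 → ℂ)
    exact HasFDerivAt.comp_hasDerivAt (f := fun t : ℂ => t • (Pi.single j 1 : Fin 4 → ℂ)) 0
      (by simpa using hd.hasFDerivAt) hl
  have h2 : HasDerivAt (fun t : ℂ => t ^ 2 * q.eval t) 0 0 := by
    simpa using (hasDerivAt_pow 2 (0 : ℂ)).fun_mul (q.hasDerivAt 0)
  simp only [hline] at h1
  simpa using h1.unique h2

open MvPolynomial in
/-- Contact equivalence by a polynomial coordinate change tangent to the identity. -/
theorem kEquivalent_pairMap_bind₁ (f g : MvPolynomial (Fin 4) ℂ)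
    {s : Fin 4 → MvPolynomial (Fin 4) ℂ}
    (hs : ∀ (i j : Fin 4) {A : Type} [CommRing A] [Algebra ℂ A] (ε : A), ε ^ 2 = 0 →
      aeval (Pi.single j ε : Fin 4 → A) (s i) = 0) :
    KEquivalent (pairMap f g)
      (pairMap (bind₁ (fun i => X i + s i) f) (bind₁ (fun i => X i + s i) g)) := by
  have an : ∀ G : MvPolynomial (Fin 4) ℂ, AnalyticAt ℂ (fun u => eval u G) 0 := fun G =>
    AnalyticOnNhd.eval_mvPolynomial G 0 (Set.mem_univ _)
  refine KEquivalent.of_coordinates (φ := fun v i => eval v (X i + s i))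
    (φ' := ContinuousLinearEquiv.refl ℂ _) (A := fun _ => 1) (AnalyticAt.pi fun i => an _)
    (by ext i; simpa [aeval_zero] using hs i i (0 : ℂ) (by simp)) ?_
    (fun i j => analyticAt_const) (by simp) ?_
  · refine hasFDerivAt_pi'.2 fun i => ?_
    have h1 : HasFDerivAt (fun v : Fin 4 → ℂ => v i)
      (ContinuousLinearMap.proj i : (Fin 4 → ℂ) →L[ℂ] ℂ) 0 := hasFDerivAt_apply i 0
    simp only [map_add, eval_X]
    refine (h1.add (hasFDerivAt_eval_zero (hs i))).congr_fderiv ?_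
    ext u
    simp
  · refine Filter.Eventually.of_forall fun v => ?_
    have h : ∀ F : MvPolynomial (Fin 4) ℂ,
        eval v (bind₁ (fun i => X i + s i) F) = eval (fun i => eval v (X i + s i)) F := fun F => by
      rw [eval, eval₂Hom_bind₁]; rfl
    simp only [pairMap, h, Matrix.one_mulVec]

/-- Contact equivalence by a linear coordinate change and a constant matrix. -/
theorem kEquivalent_pairMap_of_linear {f g f₁ g₁ : MvPolynomial (Fin 4) ℂ}
    (J K : Matrix (Fin 4) (Fin 4) ℂ) (hJK : J * K = 1) (M : Matrix (Fin 2) (Fin 2) ℂ)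
    (hM : M.det ≠ 0) (h : ∀ v, pairMap f g (J.mulVec v) = M.mulVec (pairMap f₁ g₁ v)) :
    KEquivalent (pairMap f g) (pairMap f₁ g₁) := by
  have hKJ : K * J = 1 := mul_eq_one_comm.1 hJK
  have an : ∀ N : Matrix (Fin 4) (Fin 4) ℂ, AnalyticAt ℂ (fun v => N.mulVec v) 0 := fun N =>
    (LinearMap.toContinuousLinearMap N.mulVecLin).analyticAt 0
  exact ⟨fun v => J.mulVec v, fun v => K.mulVec v, fun _ => M, an J, by simp, an K, by simp,
    Filter.Eventually.of_forall fun v => by simp [hKJ],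
    Filter.Eventually.of_forall fun v => by simp [hJK], fun _ _ => analyticAt_const, hM,
    Filter.Eventually.of_forall h⟩

namespace VirtualSing

open MvPolynomial

/-! ### Normal forms of the quadratic parts, and the shifts -/

/-- The first component of the deformation of `S` in linear coordinates, and for a basis of the
pencil, in which the quadratic parts of the two components are combinations of `x y, z ^ 2, w ^ 2`
and of `z w, x ^ 2`, as for a cusp. It is written over an arbitrary commutative ring, so that it can
be evaluated at nilpotent elements without expanding polynomials. -/
noncomputable def normalForm₁ {A : Type*} [CommRing A] (x y z w : A) : VirtualSing → A
  | J' => x * y - 2 * z ^ 2 - w ^ 2 - 2 * (-(7 * x + y - 6 * z + 4 * w) ^ 2 * (x - z)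
      + (7 * x + y - 6 * z + 4 * w) * (2 * x - z + w) ^ 2)
  | K' => x * y - 2 * z ^ 2 - w ^ 2 + 2 * ((x + y + 2 * z - 2 * w) * (x + z - w) * (y + z - w))
  | Kflat => x * y - 2 * z ^ 2 - w ^ 2 - 2 * ((x + y + 2 * z - 2 * w) ^ 2 * (w - x))
  | L => x * y + z ^ 2 - (-3 * x + y + 3 * z + w) * (-x + y + 2 * z) * (-2 * x + z + w)
  | Lsharp => -x * y + z ^ 2 - (3 * x + y - 3 * z + w) ^ 2 * (x + w)
  | M => x * y + (z - w - y - 2 * x) ^ 3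
  | Msharp => x * y + z ^ 2 - (-x + y + 2 * z + w) ^ 2 * (-x + z + w)
  | I => x * y - (-x + y + z - w) ^ 3

/-- The second component of the deformation of `S`; see `normalForm₁`. -/
noncomputable def normalForm₂ {A : Type*} [CommRing A] (x y z w : A) : VirtualSing → A
  | J' => x ^ 2 + z * w + (-(7 * x + y - 6 * z + 4 * w) ^ 2 * (x - z)
      + (7 * x + y - 6 * z + 4 * w) * (2 * x - z + w) ^ 2)
  | K' => z * w - (x + y + 2 * z - 2 * w) * (x + z - w) * (y + z - w)
  | Kflat => z * w + (x + y + 2 * z - 2 * w) ^ 2 * (w - x)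
  | L => x ^ 2 - z * w - (-3 * x + y + 3 * z + w) * (-x + y + 2 * z) * (-2 * x + z + w)
  | Lsharp => x ^ 2 + z * w - (3 * x + y - 3 * z + w) ^ 2 * (x + w)
  | M => x ^ 2 + z * w
  | Msharp => z * w + (-x + y + 2 * z + w) ^ 2 * (-x + z + w)
  | I => z * w - (-x + y + z - w) ^ 3

/-! For each singularity, the displacement of a coordinate change tangent to the identity which
brings the normal form into the shape required by `HasCuspShape`. It is found by removing, degree by
degree, the monomials outside `𝔪 · (x y, z w, x ^ γ₃, y ^ γ₄, z ^ γ₁, w ^ γ₂)`: those of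
degree `k` are cancelled through the quadratic parts by a displacement of degree `k - 1`. -/

noncomputable def shiftJ' {A : Type*} [CommRing A] (_ y z w : A) : Fin 4 → A := ![
  2 * y * z - 2 * y * w + y ^ 3 - 16 * y ^ 2 * z + 16 * y ^ 2 * w - 16 * y ^ 4 + 208 * y ^ 3 * z
    - 200 * y ^ 3 * w + 272 * y ^ 5 - 3496 * y ^ 4 * z + 3232 * y ^ 4 * w,
  0,
  4 * y ^ 4 - 132 * y ^ 5,
  -y ^ 2 + 8 * y ^ 3 - 100 * y ^ 4 + 1580 * y ^ 5]

noncomputable def shiftK' {A : Type*} [CommRing A] (x y z w : A) : Fin 4 → A := ![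
  -6 * y * z + 4 * y * w + 7 * y ^ 3 + 100 * y ^ 2 * z - 68 * y ^ 2 * w,
  -6 * x * z + 4 * x * w + 7 * x ^ 3 + 100 * x ^ 2 * z - 68 * x ^ 2 * w,
  -x ^ 2 - y ^ 2 + 16 * x ^ 3 + 16 * y ^ 3,
  x ^ 2 + y ^ 2 - 18 * x ^ 3 - 18 * y ^ 3]

noncomputable def shiftKflat {A : Type*} [CommRing A] (x y z w : A) : Fin 4 → A := ![
  -4 * y * z + 2 * y * w + 2 * y ^ 3 + 32 * y ^ 2 * z - 20 * y ^ 2 * w - 36 * y ^ 4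
    - 544 * y ^ 3 * z + 344 * y ^ 3 * w,
  -2 * x ^ 2 - 28 * x * z + 18 * x * w,
  -5 * x ^ 2 - y ^ 2 + 6 * y ^ 3 - 100 * y ^ 4,
  4 * x ^ 2 - 4 * y ^ 3 + 72 * y ^ 4]

noncomputable def shiftL {A : Type*} [CommRing A] (x y z w : A) : Fin 4 → A := ![
  3 * y * z + y * w + w ^ 2 - 3 * y ^ 3 - 42 * y ^ 2 * z - 13 * y ^ 2 * w - 17 * y * w ^ 2
    - 10 * w ^ 3 + 394 * y ^ 2 * w ^ 2 + 356 * y * w ^ 3 - 10954 * y ^ 2 * w ^ 3,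
  -w ^ 2 + 22 * w ^ 3,
  3 * x * w - y ^ 2 - y * w - 42 * x * w ^ 2 + 10 * y ^ 3 + 17 * y ^ 2 * w + 13 * y * w ^ 2
    + 3 * w ^ 3 - 356 * y ^ 3 * w - 394 * y ^ 2 * w ^ 2 + 10954 * y ^ 3 * w ^ 2,
  -y ^ 2 + 22 * y ^ 3]

noncomputable def shiftLsharp {A : Type*} [CommRing A] (x y z w : A) : Fin 4 → A := ![
  2 * y * z - y * w - 2 * w ^ 2 + y ^ 3 - 16 * y ^ 2 * z + 11 * y ^ 2 * w + 34 * y * w ^ 2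
    - 17 * y ^ 4 + 210 * y ^ 3 * z - 170 * y ^ 3 * w - 564 * y ^ 2 * w ^ 2 + 10495 * y ^ 3 * w ^ 2,
  -7 * w ^ 2,
  11 * x * w + y ^ 2 + 2 * y * w + w ^ 2 - 7 * y ^ 3 - 29 * y ^ 2 * w + 82 * y ^ 4
    + 465 * y ^ 3 * w - 8296 * y ^ 4 * w,
  2 * y ^ 3 - 50 * y ^ 4]

noncomputable def shiftM {A : Type*} [CommRing A] (x y z w : A) : Fin 4 → A := ![
  y ^ 2 - 3 * y * z + 3 * y * w + 3 * z ^ 2 + 3 * w ^ 2 + 6 * y ^ 3 - 30 * y ^ 2 * z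
    + 30 * y ^ 2 * w + 72 * y * z ^ 2 + 72 * y * w ^ 2 + 1242 * y ^ 2 * z ^ 2
    + 1242 * y ^ 2 * w ^ 2,
  6 * z ^ 2 + 6 * w ^ 2,
  -6 * x * w - 6 * y ^ 3 - 15 * y ^ 2 * w - 360 * y ^ 3 * w,
  -6 * x * z + 6 * y ^ 3 - 15 * y ^ 2 * z - 360 * y ^ 3 * z]

noncomputable def shiftMsharp {A : Type*} [CommRing A] (x y z w : A) : Fin 4 → A := ![
  3 * y * z + y * w + 2 * w ^ 2 - 3 * y ^ 3 - 39 * y ^ 2 * z - 17 * y ^ 2 * w - 33 * y * w ^ 2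
    + 633 * y ^ 2 * w ^ 2,
  -x ^ 2 + 11 * x * z + 3 * x * w - 3 * w ^ 2 - 104 * x * w ^ 2,
  -3 * x ^ 2 + 3 * x * w - y ^ 2 - 2 * y * w - w ^ 2 + 86 * x ^ 2 * w + 11 * y ^ 3
    + 26 * y ^ 2 * w - 499 * y ^ 3 * w,
  -5 * x ^ 2 - y ^ 2 + 17 * y ^ 3]

noncomputable def shiftI {A : Type*} [CommRing A] (x y z w : A) : Fin 4 → A := ![
  y ^ 2 + 3 * y * z - 3 * y * w + 3 * z ^ 2 + 3 * w ^ 2 - 75 * y * z ^ 2 - 75 * y * w ^ 2,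
  -x ^ 2 + 3 * x * z - 3 * x * w - 3 * z ^ 2 - 3 * w ^ 2 - 75 * x * z ^ 2 - 75 * x * w ^ 2,
  -3 * x ^ 2 - 3 * x * w - 3 * y ^ 2 + 3 * y * w - w ^ 2 - 75 * x ^ 2 * w - 75 * y ^ 2 * w,
  3 * x ^ 2 - 3 * x * z + 3 * y ^ 2 + 3 * y * z + z ^ 2 - 75 * x ^ 2 * z - 75 * y ^ 2 * z]

/-- The displacement of the coordinate change for `S`, over an arbitrary commutative ring. -/
noncomputable def shift {A : Type*} [CommRing A] (x y z w : A) : VirtualSing → Fin 4 → A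
  | J' => shiftJ' x y z w
  | K' => shiftK' x y z w
  | Kflat => shiftKflat x y z w
  | L => shiftL x y z w
  | Lsharp => shiftLsharp x y z w
  | M => shiftM x y z w
  | Msharp => shiftMsharp x y z w
  | I => shiftI x y z w

theorem map_normalForm₁ {A B : Type*} [CommRing A] [CommRing B] (φ : A →+* B) (S : VirtualSing)
    (x y z w : A) : φ (normalForm₁ x y z w S) = normalForm₁ (φ x) (φ y) (φ z) (φ w) S := by
  cases S <;> simp only [normalForm₁, RingHom.map_add, RingHom.map_sub, RingHom.map_mul,
    RingHom.map_neg, RingHom.map_pow, map_ofNat]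

theorem map_normalForm₂ {A B : Type*} [CommRing A] [CommRing B] (φ : A →+* B) (S : VirtualSing)
    (x y z w : A) : φ (normalForm₂ x y z w S) = normalForm₂ (φ x) (φ y) (φ z) (φ w) S := by
  cases S <;> simp only [normalForm₂, RingHom.map_add, RingHom.map_sub, RingHom.map_mul,
    RingHom.map_neg, RingHom.map_pow, map_ofNat]

theorem map_shift {A B : Type*} [CommRing A] [CommRing B] (φ : A →+* B) (S : VirtualSing)
    (x y z w : A) (i : Fin 4) : φ (shift x y z w S i) = shift (φ x) (φ y) (φ z) (φ w) S i := by
  cases S <;> fin_cases i <;>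
    simp [shift, shiftJ', shiftK', shiftKflat, shiftL, shiftLsharp, shiftM, shiftMsharp, shiftI,
      RingHom.map_add, RingHom.map_sub, RingHom.map_mul, RingHom.map_neg, RingHom.map_pow,
      map_ofNat]

/-- The displacements contain neither constant nor linear terms. -/
theorem shift_axis {A : Type*} [CommRing A] {ε : A} (hε : ε ^ 2 = 0) (S : VirtualSing)
    (i j : Fin 4) : shift ((Pi.single j ε : Fin 4 → A) 0) ((Pi.single j ε : Fin 4 → A) 1)
      ((Pi.single j ε : Fin 4 → A) 2) ((Pi.single j ε : Fin 4 → A) 3) S i = 0 := by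
  cases S <;> fin_cases i <;> fin_cases j <;>
    simp [shift, shiftJ', shiftK', shiftKflat, shiftL, shiftLsharp, shiftM, shiftMsharp, shiftI,
      pow_eq_zero_of_le _ hε]

/-- The displacement `shift` as a polynomial, so that the coordinate change is
`X i + shiftPoly S i`. -/
noncomputable def shiftPoly (S : VirtualSing) (i : Fin 4) : MvPolynomial (Fin 4) ℂ :=
  shift x y z w S i

theorem aeval_bind₁_normalForm₁ {A : Type*} [CommRing A] [Algebra ℂ A] (S : VirtualSing)
    (v : Fin 4 → A) :
    aeval v (bind₁ (fun i => X i + shiftPoly S i) (normalForm₁ x y z w S)) =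
      normalForm₁ (v 0 + shift (v 0) (v 1) (v 2) (v 3) S 0)
        (v 1 + shift (v 0) (v 1) (v 2) (v 3) S 1) (v 2 + shift (v 0) (v 1) (v 2) (v 3) S 2)
        (v 3 + shift (v 0) (v 1) (v 2) (v 3) S 3) S := by
  rw [aeval_bind₁, ← AlgHom.coe_toRingHom, map_normalForm₁]
  simp only [AlgHom.coe_toRingHom, x, y, z, w, aeval_X, map_add]
  simp only [shiftPoly, ← AlgHom.coe_toRingHom, map_shift]
  simp only [AlgHom.coe_toRingHom, x, y, z, w, aeval_X]

theorem aeval_bind₁_normalForm₂ {A : Type*} [CommRing A] [Algebra ℂ A] (S : VirtualSing)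
    (v : Fin 4 → A) :
    aeval v (bind₁ (fun i => X i + shiftPoly S i) (normalForm₂ x y z w S)) =
      normalForm₂ (v 0 + shift (v 0) (v 1) (v 2) (v 3) S 0)
        (v 1 + shift (v 0) (v 1) (v 2) (v 3) S 1) (v 2 + shift (v 0) (v 1) (v 2) (v 3) S 2)
        (v 3 + shift (v 0) (v 1) (v 2) (v 3) S 3) S := by
  rw [aeval_bind₁, ← AlgHom.coe_toRingHom, map_normalForm₂]
  simp only [AlgHom.coe_toRingHom, x, y, z, w, aeval_X, map_add]
  simp only [shiftPoly, ← AlgHom.coe_toRingHom, map_shift]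
  simp only [AlgHom.coe_toRingHom, x, y, z, w, aeval_X]

theorem kEquivalent_normalForm_shift (S : VirtualSing) :
    KEquivalent (pairMap (normalForm₁ x y z w S) (normalForm₂ x y z w S))
      (pairMap (bind₁ (fun i => X i + shiftPoly S i) (normalForm₁ x y z w S))
        (bind₁ (fun i => X i + shiftPoly S i) (normalForm₂ x y z w S))) := by
  refine kEquivalent_pairMap_bind₁ _ _ fun i j A _ _ ε hε => ?_
  rw [shiftPoly, ← AlgHom.coe_toRingHom, map_shift]
  simp only [AlgHom.coe_toRingHom, x, y, z, w, aeval_X]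
  exact shift_axis hε S i j

/-! ### The shape of the shifted normal forms -/

/-- The exponents `γ₁, γ₂, γ₃, γ₄` of the cusp singularity attached to `S`. -/
def cuspExponent : VirtualSing → Fin 4 → ℕ
  | J' => ![2, 2, 2, 6]
  | K' => ![2, 2, 4, 4]
  | Kflat => ![2, 2, 3, 5]
  | L => ![2, 4, 2, 4]
  | Lsharp => ![2, 3, 2, 5]
  | M => ![3, 3, 2, 4]
  | Msharp => ![2, 3, 3, 4]
  | I => ![3, 3, 3, 3]

/-- The coefficients of `x y`, `z ^ γ₁`, `w ^ γ₂` in the first polynomial of the normal form after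
the coordinate change `shiftPoly`. -/
def cuspCoeff₁ : VirtualSing → Fin 3 → ℂ
  | J' | K' | Kflat => ![1, -2, -1]
  | L => ![1, 1, 1]
  | Lsharp => ![-1, 1, -1]
  | M | Msharp => ![1, 1, -1]
  | I => ![1, -1, 1]

/-- The coefficients of `z w`, `x ^ γ₃`, `y ^ γ₄` in the second polynomial of the normal form after
the coordinate change `shiftPoly`. -/
def cuspCoeff₂ : VirtualSing → Fin 3 → ℂ
  | J' | K' | M => ![1, 1, 1]
  | Kflat => ![1, -1, -2]
  | L => ![-1, 1, 1]
  | Lsharp | I => ![1, 1, -1]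
  | Msharp => ![1, -1, -1]

set_option maxHeartbeats 1000000 in
theorem hasCuspShape_normalForm₁ (S : VirtualSing) :
    HasCuspShape (cuspExponent S 0) (cuspExponent S 1) (cuspExponent S 2) (cuspExponent S 3)
      (cuspCoeff₁ S 0) 0 0 0 (cuspCoeff₁ S 1) (cuspCoeff₁ S 2)
      (bind₁ (fun i => X i + shiftPoly S i) (normalForm₁ x y z w S)) := by
  constructor
  case planeXZ | planeXW | planeYZ | planeYW =>
    intro A _ _ σ τ hσ hτ
    rw [aeval_bind₁_normalForm₁]
    cases S <;> simp only [cuspExponent, Matrix.cons_val] at hσ hτ <;>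
    simp [normalForm₁, shift, shiftJ', shiftK', shiftKflat, shiftL, shiftLsharp, shiftM,
      shiftMsharp, shiftI] <;>
    ring_nf <;>
    try simp [pow_eq_zero_of_le _ hσ, pow_eq_zero_of_le _ hτ]
  all_goals
    intro A _ _ σ hσ
    rw [aeval_bind₁_normalForm₁]
    cases S <;> try simp only [cuspExponent, Matrix.cons_val] at hσ
    all_goals
      simp [normalForm₁, shift, shiftJ', shiftK', shiftKflat, shiftL, shiftLsharp, shiftM,
        shiftMsharp, shiftI, cuspExponent, cuspCoeff₁, map_ofNat] <;>
      ring_nf <;>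
      try simp [pow_eq_zero_of_le _ hσ]

set_option maxHeartbeats 1000000 in
theorem hasCuspShape_normalForm₂ (S : VirtualSing) :
    HasCuspShape (cuspExponent S 0) (cuspExponent S 1) (cuspExponent S 2) (cuspExponent S 3)
      0 (cuspCoeff₂ S 0) (cuspCoeff₂ S 1) (cuspCoeff₂ S 2) 0 0
      (bind₁ (fun i => X i + shiftPoly S i) (normalForm₂ x y z w S)) := by
  constructor
  case planeXZ | planeXW | planeYZ | planeYW =>
    intro A _ _ σ τ hσ hτ
    rw [aeval_bind₁_normalForm₂]
    cases S <;> simp only [cuspExponent, Matrix.cons_val] at hσ hτ <;>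
    simp [normalForm₂, shift, shiftJ', shiftK', shiftKflat, shiftL, shiftLsharp, shiftM,
      shiftMsharp, shiftI] <;>
    ring_nf <;>
    try simp [pow_eq_zero_of_le _ hσ, pow_eq_zero_of_le _ hτ]
  all_goals
    intro A _ _ σ hσ
    rw [aeval_bind₁_normalForm₂]
    cases S <;> try simp only [cuspExponent, Matrix.cons_val] at hσ
    all_goals
      simp [normalForm₂, shift, shiftJ', shiftK', shiftKflat, shiftL, shiftLsharp, shiftM,
        shiftMsharp, shiftI, cuspExponent, cuspCoeff₂, map_ofNat] <;>
      ring_nf <;>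
      try simp [pow_eq_zero_of_le _ hσ]

theorem kEquivalent_normalForm_cusp (S : VirtualSing) :
    KEquivalent (pairMap (normalForm₁ x y z w S) (normalForm₂ x y z w S))
      (cusp (cuspExponent S 0) (cuspExponent S 1) (cuspExponent S 2) (cuspExponent S 3)) := by
  refine (kEquivalent_normalForm_shift S).trans (kEquivalent_cusp_of_hasCuspShape ?_ ?_ ?_ ?_ ?_ ?_
    (hasCuspShape_normalForm₁ S) (hasCuspShape_normalForm₂ S) ?_ ?_ ?_ ?_ ?_ ?_) <;>
  cases S <;> simp [cuspExponent, cuspCoeff₁, cuspCoeff₂]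

/-! ### The linear coordinate changes -/

/-- The linear coordinate change which brings the quadratic part of the deformation of `S` into
normal form. -/
def linearChange : VirtualSing → Matrix (Fin 4) (Fin 4) ℂ
  | J' => !![7, 1, -6, 4; 1, 0, 0, 0; 1, 0, -1, 0; 2, 0, -1, 1]
  | K' | Kflat => !![1, 1, 2, -2; 1, 0, 0, 0; 0, 0, 1, 0; 1, 0, 1, -1]
  | L => !![-3, 1, 3, 1; 0, 0, 1, 0; -1, 0, 1, 0; -1, 1, 2, 0]
  | Lsharp => !![3, 1, -3, 1; 1, 0, 0, 0; 1, 0, -1, 0; 2, 0, -1, 1]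
  | M => !![-2, 0, 1, -1; 0, 0, 0, -1; -2, -1, 1, -1; 1, 0, 0, 1]
  | Msharp => !![-1, 1, 2, 1; 1, 0, 0, 0; 1, 0, -1, 0; -1, 0, 1, 1]
  | I => !![1, 0, 0, 0; 0, 1, 0, 0; -1, 0, 1, 0; -1, 1, 1, -1]

/-- The inverse of `linearChange`. -/
def linearChangeInv : VirtualSing → Matrix (Fin 4) (Fin 4) ℂ
  | J' => !![0, 1, 0, 0; 1, 3, -2, -4; 0, 1, -1, 0; 0, -1, -1, 1]
  | K' | Kflat => !![0, 1, 0, 0; 1, 1, 0, -2; 0, 0, 1, 0; 0, 1, 1, -1]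
  | L => !![0, 1, -1, 0; 0, -1, -1, 1; 0, 1, 0, 0; 1, 1, -2, -1]
  | Lsharp => !![0, 1, 0, 0; 1, 1, -2, -1; 0, 1, -1, 0; 0, -1, -1, 1]
  | M => !![0, 1, 0, 1; 1, 0, -1, 0; 1, 1, 0, 2; 0, -1, 0, 0]
  | Msharp => !![0, 1, 0, 0; 1, -1, 1, -1; 0, 1, -1, 0; 0, 0, 1, 1]
  | I => !![1, 0, 0, 0; 0, 1, 0, 0; 1, 0, 1, 0; 0, 1, 1, -1]

/-- The matrix which expresses the two equations of the deformation in the new coordinates by those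
of the normal form. -/
def pencilChange : VirtualSing → Matrix (Fin 2) (Fin 2) ℂ
  | J' | K' | Kflat => !![1, 2; 0, 1]
  | L => !![1, -1; 1, 0]
  | Lsharp => !![-1, 1; 0, 1]
  | M => !![0, -1; 1, 1]
  | Msharp => !![1, 1; 0, 1]
  | I => !![1, 0; -1, 1]

theorem linearChange_mul_linearChangeInv (S : VirtualSing) :
    linearChange S * linearChangeInv S = 1 := by
  cases S <;> ext i j <;> fin_cases i <;> fin_cases j <;>
    simp [linearChange, linearChangeInv, Matrix.mul_apply, Fin.sum_univ_four] <;> norm_num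

theorem kEquivalent_deformation_normalForm (S : VirtualSing) :
    KEquivalent (deformation S) (pairMap (normalForm₁ x y z w S) (normalForm₂ x y z w S)) := by
  refine kEquivalent_pairMap_of_linear (linearChange S) (linearChangeInv S)
    (linearChange_mul_linearChangeInv S) (pencilChange S) ?_ fun v => ?_
  · cases S <;> simp [pencilChange, Matrix.det_fin_two]
  · simp only [pairMap, map_normalForm₁, map_normalForm₂]
    ext i
    cases S <;> fin_cases i <;>
      simp [gabrielovH₁, h₁, h₂, x, y, z, w, normalForm₁, normalForm₂, linearChange, pencilChange,
        Matrix.mulVec, dotProduct, Fin.sum_univ_four, Fin.sum_univ_two] <;>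
      ring

theorem hasGabrielovNumbers_cuspExponent (S : VirtualSing) :
    S.HasGabrielovNumbers (cuspExponent S 0) (cuspExponent S 1) (cuspExponent S 2)
      (cuspExponent S 3) :=
  (kEquivalent_deformation_normalForm S).trans (kEquivalent_normalForm_cusp S)

end VirtualSing

theorem mainTheorem2 :
    VirtualSing.J'.HasGabrielovNumbers 2 2 2 6 ∧
    VirtualSing.K'.HasGabrielovNumbers 2 2 4 4 ∧
    VirtualSing.Kflat.HasGabrielovNumbers 2 2 3 5 ∧
    VirtualSing.L.HasGabrielovNumbers 2 4 2 4 ∧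
    VirtualSing.Lsharp.HasGabrielovNumbers 2 3 2 5 ∧
    VirtualSing.M.HasGabrielovNumbers 3 3 2 4 ∧
    VirtualSing.Msharp.HasGabrielovNumbers 2 3 3 4 ∧
    VirtualSing.I.HasGabrielovNumbers 3 3 3 3 := by
  open VirtualSing in
  exact ⟨hasGabrielovNumbers_cuspExponent J', hasGabrielovNumbers_cuspExponent K',
    hasGabrielovNumbers_cuspExponent Kflat, hasGabrielovNumbers_cuspExponent L,
    hasGabrielovNumbers_cuspExponent Lsharp, hasGabrielovNumbers_cuspExponent M,
    hasGabrielovNumbers_cuspExponent Msharp, hasGabrielovNumbers_cuspExponent I⟩
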